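/- **Conventions.** Metric spaces are non-empty; isometries are surjective; a geodesic from $x$ to $y$ in $L$ is an isometric embedding $c\colon[0,d(x,y)]\to L$ with $c(0)=x$, $c(d(x,y))=y$. A $k$-marked group $\mathbf G=(G;s_1,\dots,s_k)$ is a group with an ordered $k$-tuple of generators, up to isomorphism preserving the generators (equivalently, a normal subgroup of the free group $F_k$). The space $\mathcal G(k)$ of $k$-marked groups carries the Cayley topology, induced from the product topology on $\{0,1\}^{F_k}$. $\mathrm{Cay}(\mathbf G)$ is the graph on $G$ with edges $\{g,s_jg\}$ and $d_{\mathbf G}$ is its path metric. The Cayley boundary $\partial_{\mathrm{Cay}}(\mathbf G_m)_m$ is the set of accumulation points of the sequence $(\mathbf G_m)_{m\in\mathbb N}$ in $\mathcal G(k)$. In a disjoint union $\bigsqcup_m X_m$ of metric spaces, points of distinct components have distance $+\infty$. $\rho,\omega$ always denote non-decreasing functions $[0,\infty)\to[0,\infty)$ tending to $+\infty$ at $+\infty$. Let $\mathcal M$ be a class of metric spaces. *Equivariant control pairs.* $\mathcal{CP}^\sharp_{\mathcal M}(\mathbf G)$ is the set of pairs $(\rho,\omega)$ for which there are $M\in\mathcal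 M$, a right action $\alpha$ of $G$ on $M$ by isometries, and $y\in M$ with $\rho(d_{\mathbf G}(g,h))\le d_M(y\cdot\alpha(g),y\cdot\alpha(h))\le\omega(d_{\mathbf G}(g,h))$ for all $g,h\in G$. A set $K\subseteq\mathcal G(k)$ is uniformly a-$\mathcal M$-menable if $\bigcap_{\mathbf G\in K}\mathcal{CP}^\sharp_{\mathcal M}(\mathbf G)\neq\emptyset$. *Fibred control pairs.* For $X=\bigsqcup_mX_m$, $\mathcal{CP}^{\mathrm{fib}}_{\mathcal M}(X)$ is the set of pairs $(\rho,\omega)$ for which there are $M\in\mathcal M$, metric spaces $(M_x)_{x\in X}$ isometric to $M$ and points $s(x)\in M_x$ such that for every $R\ge0$ there is $m^{(R)}\geq 1$ with the following property: for each non-empty $C\subseteq\bigsqcup_{m\ge m^{(R)}}X_m$ of diameter at most $R$ there are isometries $t_{C}(x)\colon M_x\to M$ $(x\in C)$, which may depend on $R$, such that (1) $\rho(d(x_1,x_2))\le d_M(t_C(x_1)s(x_1),t_C(x_2)s(x_2))\le\omega(d(x_1,x_2))$ for all $x_1,x_2\in C$; (2) if two such sets $C_1,C_2$ meet, then $t_{C_1}(x)\circ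 t_{C_2}(x)^{-1}$ is the same isometry of $M$ for all $x\in C_1\cap C_2$. $X$ admits a fibred coarse embedding into $\mathcal M$ as a disjoint union if $\mathcal{CP}^{\mathrm{fib}}_{\mathcal M}(X)\ne\emptyset$. *Operations on classes* ($q\in[1,\infty)$). For pointed metric spaces $(M_j,y_j)_{j\in B}$ and $r_j>0$, the pointed $\ell_q$-product with scaling $(r_j)_j$ is $\{(z_j)_j:\sum_j(r_jd(z_j,y_j))^q<\infty\}$ with the metric $(\sum_j(r_jd(z_j,w_j))^q)^{1/q}$. For pointed metric spaces $(N_m,y_m)_{m\in\mathbb N}$ and an ultrafilter $\mathcal U$ on $\mathbb N$, $\lim_{\mathcal U}(N_m,y_m)$ is the space of sequences $(z_m)_m$ with $\sup_md(z_m,y_m)<\infty$, with the metric $\lim_{\mathcal U}d(z_m,w_m)$, sequences at distance $0$ being identified. - $\mathcal F_q(\mathcal M)$: all spaces isometric to $\lim_{\mathcal U}(N_m,y_m)$, where $\mathcal U$ is a non-principal ultrafilter on $\mathbb N$, $N_m$ is the $\ell_q$-product of copies of one $M\in\mathcal M$ (the same for all $m$) over a non-empty finite set $F^{(m)}$ with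 constant scaling $\sharp(F^{(m)})^{-1/q}$, $\sharp(F^{(m)})\to\infty$, and $y_m\in N_m$. Write $\mathcal F_q(M)=\mathcal F_q(\{M\})$. - $\mathcal{FS}_q(\mathcal M)$: all spaces isometric to a non-empty closed subset $L_0$ of some $L\in\mathcal F_q(\mathcal M)$ such that every geodesic of $L$ with end points in $L_0$ lies in $L_0$. For a class $\mathcal M$ of Banach spaces, $\mathcal{FS}_q(\mathcal M)$ is instead the class of all Banach spaces isometrically affinely isomorphic to a non-empty closed affine subspace of some $L\in\mathcal F_q(\mathcal M)$ (affine combinations in $L$ being formed coordinatewise, over the given scalar field $\mathbb R$ or $\mathbb C$). - $\ell_q(\mathcal M)$: all spaces isometric to a pointed $\ell_q$-product, with all scaling factors $1$, of a non-empty, at most countable family of pointed members of $\mathcal M$. **Theorem.** Let $\mathcal M$ be a non-empty class of metric spaces, $k\ge1$, $(\mathbf G_m)_{m\in\mathbb N}$ a sequence in $\mathcal G(k)$, and $X=\bigsqcup_{m}\mathrm{Cay}(\mathbf G_m)$. (i)(1) Assume that all $\mathbf G_m$ are finite. Then for every $q\in[1,\infty)$: if $X$ admits a fibred coarse embedding into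 $\mathcal M$ as a disjoint union, then $\partial_{\mathrm{Cay}}(\mathbf G_m)_m$ is uniformly a-$\mathcal F_q(\mathcal M)$-menable. Moreover, $$\mathcal{CP}^{\mathrm{fib}}_{\mathcal M}(X)\subseteq\bigcap_{\mathbf G_\infty\in\partial_{\mathrm{Cay}}(\mathbf G_m)_m}\mathcal{CP}^\sharp_{\mathcal F_q(\mathcal M)}(\mathbf G_\infty).$$ (i)(2) Assume that all $\mathbf G_m$ are amenable, and that either $q\in(1,\infty)$ is such that for every $M\in\mathcal M$ some $L\in\mathcal F_q(M)$ is uniquely geodesic (any two points are joined by exactly one geodesic), or $\mathcal M$ consists only of Banach spaces and $q\in[1,\infty)$ is arbitrary. If $X$ admits a fibred coarse embedding into $\mathcal M$ as a disjoint union, then $\partial_{\mathrm{Cay}}(\mathbf G_m)_m$ is uniformly a-$\mathcal{FS}_q(\mathcal M)$-menable. Moreover, $$\mathcal{CP}^{\mathrm{fib}}_{\mathcal M}(X)\subseteq\bigcap_{\mathbf G_\infty\in\partial_{\mathrm{Cay}}(\mathbf G_m)_m}\mathcal{CP}^\sharp_{\mathcal{FS}_q(\mathcal M)}(\mathbf G_\infty).$$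 (ii) For every $q\in[1,\infty)$: if $\partial_{\mathrm{Cay}}(\mathbf G_m)_m$ is uniformly a-$\mathcal M$-menable, then $X$ admits a fibred coarse embedding into $\ell_q(\mathcal M)$ as a disjoint union. Moreover, $$\bigcap_{\mathbf G_\infty\in\partial_{\mathrm{Cay}}(\mathbf G_m)_m}\mathcal{CP}^\sharp_{\mathcal M}(\mathbf G_\infty)\subseteq\mathcal{CP}^{\mathrm{fib}}_{\ell_q(\mathcal M)}(X).$$ If $(\mathbf G_m)_m$ converges in $\mathcal G(k)$ to $\mathbf G_\infty$, then $\ell_q(\mathcal M)$ may be replaced by $\mathcal M$ in both assertions; in particular $\mathcal{CP}^\sharp_{\mathcal M}(\mathbf G_\infty)\subseteq\mathcal{CP}^{\mathrm{fib}}_{\mathcal M}(X)$. -/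

import Mathlib

open Filter Topology
open scoped NNReal ENNReal

universe u v

noncomputable section

/-! ## Marked groups, Cayley graphs and the Cayley topology -/

/-- A `k`-marked group `(G; s₁, …, s_k)`, up to isomorphism of marked groups, is the same thing as
a normal subgroup of the free group of rank `k` (the kernel of the marked quotient map). -/
structure MarkedGroup (k : ℕ) where
  /-- the kernel of the marked quotient map from the free group -/
  ker : Subgroup (FreeGroup (Fin k))
  /-- the kernel is a normal subgroup -/
  normal : ker.Normal

namespace MarkedGroup

variable {k : ℕ}

instance (G : MarkedGroup k) : G.ker.Normal := G.normal

/-- The underlying group of a marked group. -/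
def Carrier (G : MarkedGroup k) : Type := FreeGroup (Fin k) ⧸ G.ker

instance (G : MarkedGroup k) : Group G.Carrier :=
  inferInstanceAs (Group (FreeGroup (Fin k) ⧸ G.ker))

/-- The marked quotient map from the free group. -/
def proj (G : MarkedGroup k) : FreeGroup (Fin k) →* G.Carrier := QuotientGroup.mk' G.ker

/-- The `j`-th generator. -/
def gen (G : MarkedGroup k) (j : Fin k) : G.Carrier := G.proj (FreeGroup.of j)

/-- The Cayley graph: `g` and `s_j g` are joined by an edge, for every `g` and `j`. -/
def cay (G : MarkedGroup k) : SimpleGraph G.Carrier :=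
  SimpleGraph.fromRel fun g h => ∃ j, h = G.gen j * g

theorem cay_reachable_gen_mul (G : MarkedGroup k) (j : Fin k) (g : G.Carrier) :
    G.cay.Reachable g (G.gen j * g) := by
  by_cases h : g = G.gen j * g
  · exact h ▸ SimpleGraph.Reachable.refl g
  · exact SimpleGraph.Adj.reachable ((SimpleGraph.fromRel_adj _ _ _).2 ⟨h, Or.inl ⟨j, rfl⟩⟩)

theorem cay_connected (G : MarkedGroup k) : G.cay.Connected := by
  have key : ∀ (w : FreeGroup (Fin k)) (g : G.Carrier), G.cay.Reachable g (G.proj w * g) := by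
    intro w
    induction w using FreeGroup.induction_on with
    | C1 => intro g; simp
    | of j => intro g; exact G.cay_reachable_gen_mul j g
    | inv_of j _ =>
      intro g
      have h := G.cay_reachable_gen_mul j ((G.gen j)⁻¹ * g)
      rw [mul_inv_cancel_left] at h
      rw [map_inv]
      exact h.symm
    | mul x y hx hy =>
      intro g
      rw [map_mul, mul_assoc]
      exact (hy g).trans (hx _)
  refine ⟨fun g h => ?_⟩
  obtain ⟨w, hw⟩ := QuotientGroup.mk'_surjective G.ker (h * g⁻¹)
  have h1 := key w g
  have h2 : G.proj w * g = h := by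
    have : G.proj w = h * g⁻¹ := hw
    rw [this, inv_mul_cancel_right]
  rwa [h2] at h1

/-- The underlying group, with the shortest path metric of the Cayley graph, that is, the
right-invariant word metric. -/
instance (G : MarkedGroup k) : MetricSpace G.Carrier where
  dist g h := (G.cay.dist g h : ℝ)
  dist_self g := by simp
  dist_comm g h := by rw [SimpleGraph.dist_comm]
  dist_triangle a b c := by exact_mod_cast G.cay_connected.dist_triangle
  eq_of_dist_eq_zero {a b} h := by
    have h' : G.cay.dist a b = 0 := by exact_mod_cast h
    exact G.cay_connected.dist_eq_zero_iff.1 h'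

open Classical in
/-- The indicator function in `{0,1}^{F_k}` of the kernel of a marked group. -/
def code (G : MarkedGroup k) : FreeGroup (Fin k) → Bool := fun w => decide (w ∈ G.ker)

/-- The Cayley topology on the space of `k`-marked groups: the topology induced from the product
topology on `{0,1}^{F_k}`. -/
instance : TopologicalSpace (MarkedGroup k) := TopologicalSpace.induced code inferInstance

end MarkedGroup

/-- The Cayley boundary: the set of all accumulation points of the sequence. -/
def cayleyBoundary {k : ℕ} (G : ℕ → MarkedGroup k) : Set (MarkedGroup k) :=
  {H | MapClusterPt H atTop G}

open Classical in
/-- Amenability of a discrete group (Følner's condition): for all finite `K` and all `ε > 0`, there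
is a nonempty finite set `F` with `#(gF ∖ F) ≤ ε #F` for all `g ∈ K`. -/
def IsAmenableGroup (Γ : Type u) [Group Γ] : Prop :=
  ∀ (K : Finset Γ) (ε : ℝ), 0 < ε → ∃ F : Finset Γ, F.Nonempty ∧
    ∀ g ∈ K, (((F.image fun x => g * x) \ F).card : ℝ) ≤ ε * (F.card : ℝ)

/-! ## Classes of metric spaces, control pairs and embeddings -/

/-- A class of metric spaces. -/
def MetricClass : Type (u + 1) := ∀ (X : Type u) [MetricSpace X], Prop

/-- Non-decreasing proper functions `[0,∞) → [0,∞)`. -/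
def IsControl (ρ : ℝ≥0 → ℝ≥0) : Prop := Monotone ρ ∧ Tendsto ρ atTop atTop

/-- `(ρ, ω)` is an equivariant control pair for `G` into the space `M`: there are a right action
`z ↦ z · α(g)` of `G` on `M` by surjective isometries and a point `y ∈ M` such that the orbit map
`g ↦ y · α(g)` satisfies the two inequalities. A right action is a homomorphism from the opposite
group. -/
def IsEquivariantControlPair {k : ℕ} (ρ ω : ℝ≥0 → ℝ≥0) (G : MarkedGroup k)
    (M : Type u) [MetricSpace M] : Prop :=
  ∃ (α : (G.Carrier)ᵐᵒᵖ →* (M ≃ᵢ M)) (y : M), ∀ g h : G.Carrier,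
    ρ (nndist g h) ≤ nndist (α (MulOpposite.op g) y) (α (MulOpposite.op h) y) ∧
      nndist (α (MulOpposite.op g) y) (α (MulOpposite.op h) y) ≤ ω (nndist g h)

/-- The set of all equivariant control pairs for `G` into the class `𝓜`. -/
def equivariantCP {k : ℕ} (𝓜 : MetricClass.{u}) (G : MarkedGroup k) :
    Set ((ℝ≥0 → ℝ≥0) × (ℝ≥0 → ℝ≥0)) :=
  {p | IsControl p.1 ∧ IsControl p.2 ∧
    ∃ (M : Type u) (_ : MetricSpace M), 𝓜 M ∧ IsEquivariantControlPair p.1 p.2 G M}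

/-- A set `K` of marked groups is uniformly a-`𝓜`-menable if there is a common equivariant
control pair into `𝓜` for all members of `K`. -/
def UniformlyMenable {k : ℕ} (𝓜 : MetricClass.{u}) (K : Set (MarkedGroup k)) : Prop :=
  (⋂ H ∈ K, equivariantCP 𝓜 H).Nonempty

/-- The disjoint union of a sequence of metric spaces. -/
def DisjointUnion (X : ℕ → Type v) : Type v := Σ m, X m

open Classical in
/-- The generalized metric of a disjoint union: points in distinct components have infinite
distance. -/
instance (X : ℕ → Type v) [∀ m, MetricSpace (X m)] : EMetricSpace (DisjointUnion X) where
  edist x y := if h : x.1 = y.1 then edist (h ▸ x.2 : X y.1) y.2 else ⊤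
  edist_self x := by simp
  edist_comm x y := by
    obtain ⟨i, a⟩ := x
    obtain ⟨j, b⟩ := y
    by_cases h : i = j
    · subst h
      simp [edist_comm]
    · simp [h, Ne.symm h]
  edist_triangle x y z := by
    obtain ⟨i, a⟩ := x
    obtain ⟨j, b⟩ := y
    obtain ⟨l, c⟩ := z
    by_cases h : i = j
    · subst h
      by_cases h' : i = l
      · subst h'
        simpa using edist_triangle a b c
      · simp [h']
    · simp [h]
  eq_of_edist_eq_zero {x y} hxy := by
    obtain ⟨i, a⟩ := x
    obtain ⟨j, b⟩ := y
    by_cases h : i = j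
    · subst h
      have : a = b := by simpa using hxy
      rw [this]
    · simp [h] at hxy

/-- A subset of the disjoint union that avoids the components of index `< m₀` and has diameter at
most `R`. -/
def IsSmallBeyond {X : ℕ → Type v} [∀ m, MetricSpace (X m)] (m₀ : ℕ) (R : ℝ≥0)
    (C : Set (DisjointUnion X)) : Prop :=
  C.Nonempty ∧ (∀ x ∈ C, m₀ ≤ x.1) ∧ Metric.ediam C ≤ (R : ℝ≥0∞)

/-- The disjoint union of the spaces `X m` admits a `(ρ, ω)`-fibred coarse embedding into the space
`M`, as a disjoint union. The family `t C` is the trivialization over `C`; only its values at points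
of `C` matter. It is chosen after `R` and may depend on `R`. -/
def HasFibredEmbedding (ρ ω : ℝ≥0 → ℝ≥0) (X : ℕ → Type v) [∀ m, MetricSpace (X m)]
    (M : Type u) [MetricSpace M] : Prop :=
  ∃ (fib : DisjointUnion X → Type u) (_ : ∀ x, MetricSpace (fib x)),
    (∀ x, Nonempty (fib x ≃ᵢ M)) ∧
    ∃ s : ∀ x, fib x, ∀ R : ℝ≥0, ∃ m₀ : ℕ, 1 ≤ m₀ ∧
      ∃ t : Set (DisjointUnion X) → ∀ x, fib x ≃ᵢ M,
        (∀ C, IsSmallBeyond m₀ R C → ∀ x₁ ∈ C, ∀ x₂ ∈ C,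
          ρ (edist x₁ x₂).toNNReal ≤ nndist (t C x₁ (s x₁)) (t C x₂ (s x₂)) ∧
            nndist (t C x₁ (s x₁)) (t C x₂ (s x₂)) ≤ ω (edist x₁ x₂).toNNReal) ∧
        (∀ C₁ C₂, IsSmallBeyond m₀ R C₁ → IsSmallBeyond m₀ R C₂ → (C₁ ∩ C₂).Nonempty →
          ∃ τ : M ≃ᵢ M, ∀ x ∈ C₁ ∩ C₂, (t C₂ x).symm.trans (t C₁ x) = τ)

/-- The set of all control pairs for fibred coarse embeddings, as a disjoint union, of the disjoint
union of the Cayley graphs of the `G m` into the class `𝓜`. -/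
def fibredCP {k : ℕ} (𝓜 : MetricClass.{u}) (G : ℕ → MarkedGroup k) :
    Set ((ℝ≥0 → ℝ≥0) × (ℝ≥0 → ℝ≥0)) :=
  {p | IsControl p.1 ∧ IsControl p.2 ∧ ∃ (M : Type u) (_ : MetricSpace M), 𝓜 M ∧
    HasFibredEmbedding p.1 p.2 (fun m => (G m).Carrier) M}

/-- The disjoint union of the Cayley graphs of the `G m` admits a fibred coarse embedding into `𝓜`,
as a disjoint union. -/
def AdmitsFibredEmbedding {k : ℕ} (𝓜 : MetricClass.{u}) (G : ℕ → MarkedGroup k) : Prop :=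
  (fibredCP 𝓜 G).Nonempty

/-! ## Pointed `ℓ_q`-products with scaling -/

/-- The pointed `ℓ_q`-product, with scaling factors `r j > 0`, of pointed metric spaces
`(M j, y j)`. -/
def LqProd (q : ℝ) {B : Type v} (M : B → Type u) [∀ j, MetricSpace (M j)] (y : ∀ j, M j)
    (r : B → Set.Ioi (0 : ℝ)) : Type (max u v) :=
  {z : ∀ j, M j // Summable fun j => ((r j : ℝ) * dist (z j) (y j)) ^ q}

namespace LqProd

variable {q : ℝ} {B : Type v} {M : B → Type u} [∀ j, MetricSpace (M j)] {y : ∀ j, M j}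
  {r : B → Set.Ioi (0 : ℝ)}

theorem term_nonneg (z w : ∀ j, M j) (j : B) : 0 ≤ (r j : ℝ) * dist (z j) (w j) :=
  mul_nonneg (le_of_lt (r j).2) dist_nonneg

theorem summable_triangle [Fact (1 ≤ q)] {a b c : ∀ j, M j}
    (h₁ : Summable fun j => ((r j : ℝ) * dist (a j) (b j)) ^ q)
    (h₂ : Summable fun j => ((r j : ℝ) * dist (b j) (c j)) ^ q) :
    (Summable fun j => ((r j : ℝ) * dist (a j) (c j)) ^ q) ∧
      (∑' j, ((r j : ℝ) * dist (a j) (c j)) ^ q) ^ (1 / q) ≤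
        (∑' j, ((r j : ℝ) * dist (a j) (b j)) ^ q) ^ (1 / q) +
          (∑' j, ((r j : ℝ) * dist (b j) (c j)) ^ q) ^ (1 / q) := by
  have hq : (1 : ℝ) ≤ q := Fact.out
  have hq0 : (0 : ℝ) ≤ q := by linarith
  obtain ⟨hs, hle⟩ := Real.Lp_add_le_tsum_of_nonneg hq (term_nonneg (r := r) a b)
    (term_nonneg (r := r) b c) h₁ h₂
  have hpt : ∀ j, ((r j : ℝ) * dist (a j) (c j)) ^ q ≤
      ((r j : ℝ) * dist (a j) (b j) + (r j : ℝ) * dist (b j) (c j)) ^ q := by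
    intro j
    refine Real.rpow_le_rpow (term_nonneg a c j) ?_ hq0
    rw [← mul_add]
    exact mul_le_mul_of_nonneg_left (dist_triangle _ _ _) (le_of_lt (r j).2)
  have hac : Summable fun j => ((r j : ℝ) * dist (a j) (c j)) ^ q :=
    Summable.of_nonneg_of_le (fun j => Real.rpow_nonneg (term_nonneg a c j) q) hpt hs
  refine ⟨hac, le_trans (Real.rpow_le_rpow ?_ (hac.tsum_le_tsum hpt hs) (by positivity)) hle⟩
  exact tsum_nonneg fun j => Real.rpow_nonneg (term_nonneg a c j) q

theorem summable_dist [Fact (1 ≤ q)] (z w : LqProd q M y r) :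
    Summable fun j => ((r j : ℝ) * dist (z.1 j) (w.1 j)) ^ q :=
  (summable_triangle z.2 (by simpa only [dist_comm] using w.2)).1

/-- The metric `(∑ (r j * d (z j, w j)) ^ q) ^ (1 / q)`. -/
instance [Fact (1 ≤ q)] : MetricSpace (LqProd q M y r) where
  dist z w := (∑' j, ((r j : ℝ) * dist (z.1 j) (w.1 j)) ^ q) ^ (1 / q)
  dist_self z := by
    have hq : (1 : ℝ) ≤ q := Fact.out
    have hq0 : q ≠ 0 := by linarith
    simp [Real.zero_rpow hq0, hq0]
  dist_comm z w := by simp only [dist_comm]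
  dist_triangle a b c := (summable_triangle (summable_dist a b) (summable_dist b c)).2
  eq_of_dist_eq_zero {z w} h := by
    have hq : (1 : ℝ) ≤ q := Fact.out
    have hq0 : q ≠ 0 := by linarith
    have hnn : ∀ j, 0 ≤ ((r j : ℝ) * dist (z.1 j) (w.1 j)) ^ q :=
      fun j => Real.rpow_nonneg (term_nonneg z.1 w.1 j) q
    have h0 : ∑' j, ((r j : ℝ) * dist (z.1 j) (w.1 j)) ^ q = 0 :=
      (Real.rpow_eq_zero (tsum_nonneg hnn) (by positivity)).1 h
    have h1 := (summable_dist z w).hasSum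
    rw [h0, hasSum_zero_iff_of_nonneg hnn] at h1
    refine Subtype.ext (funext fun j => ?_)
    have h2 : ((r j : ℝ) * dist (z.1 j) (w.1 j)) ^ q = 0 := congrFun h1 j
    have h3 := (Real.rpow_eq_zero (term_nonneg z.1 w.1 j) hq0).1 h2
    exact dist_eq_zero.1 ((mul_eq_zero.1 h3).resolve_left (ne_of_gt (r j).2))

theorem dist_def [Fact (1 ≤ q)] (z w : LqProd q M y r) :
    dist z w = (∑' j, ((r j : ℝ) * dist (z.1 j) (w.1 j)) ^ q) ^ (1 / q) := rfl

/-- The base point of the product. -/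
def base [Fact (1 ≤ q)] : LqProd q M y r :=
  ⟨y, by
    have hq : (1 : ℝ) ≤ q := Fact.out
    have hq0 : q ≠ 0 := by linarith
    simp [Real.zero_rpow hq0, summable_zero]⟩

end LqProd

/-! ## Pointed metric ultraproducts -/

/-- The sequences at bounded distance from the base points. -/
def BddSeq (N : ℕ → Type u) [∀ m, MetricSpace (N m)] (y : ∀ m, N m) : Type u :=
  {z : ∀ m, N m // ∃ D : ℝ, ∀ m, dist (z m) (y m) ≤ D}

/-- A copy of the bounded sequences that carries the pseudo-metric of the ultrafilter `U`. -/
def PreUltraproduct (_U : Ultrafilter ℕ) (N : ℕ → Type u) [∀ m, MetricSpace (N m)]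
    (y : ∀ m, N m) : Type u := BddSeq N y

namespace PreUltraproduct

variable {U : Ultrafilter ℕ} {N : ℕ → Type u} [∀ m, MetricSpace (N m)] {y : ∀ m, N m}

theorem exists_lim (z w : PreUltraproduct U N y) :
    ∃ l : ℝ, Tendsto (fun m => dist (z.1 m) (w.1 m)) (U : Filter ℕ) (𝓝 l) := by
  obtain ⟨D, hD⟩ := z.2
  obtain ⟨E, hE⟩ := w.2
  have hmem : ∀ m, dist (z.1 m) (w.1 m) ∈ Set.Icc (0 : ℝ) (D + E) := fun m =>
    ⟨dist_nonneg, (dist_triangle_right _ _ (y m)).trans (add_le_add (hD m) (hE m))⟩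
  have hU : ((U.map fun m => dist (z.1 m) (w.1 m) : Ultrafilter ℝ) : Filter ℝ) ≤
      𝓟 (Set.Icc (0 : ℝ) (D + E)) := by
    rw [le_principal_iff]
    exact Ultrafilter.mem_map.2 (Filter.mem_of_superset Filter.univ_mem fun m _ => hmem m)
  obtain ⟨l, -, hl⟩ := isCompact_Icc.ultrafilter_le_nhds _ hU
  exact ⟨l, hl⟩

/-- The pseudo-metric `lim_U d (z m, w m)`. -/
instance : PseudoMetricSpace (PreUltraproduct U N y) where
  dist z w := limUnder (U : Filter ℕ) fun m => dist (z.1 m) (w.1 m)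
  dist_self z := by
    refine Tendsto.limUnder_eq ?_
    simp
  dist_comm z w := by simp only [dist_comm]
  dist_triangle a b c := by
    refine le_of_tendsto_of_tendsto (tendsto_nhds_limUnder (exists_lim a c))
      ((tendsto_nhds_limUnder (exists_lim a b)).add (tendsto_nhds_limUnder (exists_lim b c))) ?_
    exact Eventually.of_forall fun m => dist_triangle _ _ _

theorem tendsto_dist (z w : PreUltraproduct U N y) :
    Tendsto (fun m => dist (z.1 m) (w.1 m)) (U : Filter ℕ) (𝓝 (dist z w)) :=
  tendsto_nhds_limUnder (exists_lim z w)

end PreUltraproduct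

/-- The pointed metric ultraproduct `lim_U (N m, y m)`: bounded sequences modulo the relation
`lim_U d (z m, w m) = 0`. -/
abbrev Ultraproduct (U : Ultrafilter ℕ) (N : ℕ → Type u) [∀ m, MetricSpace (N m)]
    (y : ∀ m, N m) : Type u := SeparationQuotient (PreUltraproduct U N y)

/-! ## The classes `F_q`, `FS_q` and `ℓ_q` -/

/-- The scaling factor `1 / (#F) ^ (1 / q)`. -/
def folnerScale (q : ℝ) (F : Type) [Fintype F] [Nonempty F] : Set.Ioi (0 : ℝ) :=
  ⟨1 / (Fintype.card F : ℝ) ^ (1 / q), by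
    have : (0 : ℝ) < Fintype.card F := by exact_mod_cast Fintype.card_pos
    exact Set.mem_Ioi.2 (by positivity)⟩

/-- The `ℓ_q`-product of copies of `M` over a finite set `F`, with constant scaling factor
`1 / (#F) ^ (1 / q)`. As a metric space it does not depend on the base point `y`, by finiteness. -/
abbrev FinProd (q : ℝ) (M : Type u) [MetricSpace M] (F : Type) [Fintype F] [Nonempty F]
    (y : F → M) : Type u :=
  LqProd q (fun _ : F => M) y (fun _ => folnerScale q F)

/-- The metric ultraproduct of finite `ℓ_q`-products of copies of `M`, with base points `y m`. -/
abbrev FolnerSpace (q : ℝ) [Fact (1 ≤ q)] (M : Type u) [MetricSpace M] (U : Ultrafilter ℕ)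
    (F : ℕ → Type) [∀ m, Fintype (F m)] [∀ m, Nonempty (F m)] (y : ∀ m, F m → M) : Type u :=
  Ultraproduct U (fun m => FinProd q M (F m) (y m)) (fun _ => LqProd.base)

/-- The data of the construction of a member of `F_q` are admissible: the ultrafilter is
non-principal and the cardinalities of the finite index sets tend to infinity. -/
def IsAdmissible (U : Ultrafilter ℕ) (F : ℕ → Type) [∀ m, Fintype (F m)] : Prop :=
  (U : Filter ℕ) ≤ cofinite ∧ Tendsto (fun m => Fintype.card (F m)) atTop atTop

/-- The class `F_q(M)` of a single space `M`. -/
def FqOf (q : ℝ) [Fact (1 ≤ q)] (M : Type u) [MetricSpace M] : MetricClass.{u} := fun X _ =>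
  ∃ (U : Ultrafilter ℕ) (F : ℕ → Type) (_ : ∀ m, Fintype (F m)) (_ : ∀ m, Nonempty (F m))
    (y : ∀ m, F m → M), IsAdmissible U F ∧ Nonempty (X ≃ᵢ FolnerSpace q M U F y)

/-- The class `F_q(𝓜)`. -/
def Fq (q : ℝ) [Fact (1 ≤ q)] (𝓜 : MetricClass.{u}) : MetricClass.{u} := fun X _ =>
  ∃ (M : Type u) (_ : MetricSpace M), 𝓜 M ∧ FqOf q M X

/-- `c` is a (minimal) geodesic from `x` to `y`. -/
def IsGeodesic {L : Type u} [MetricSpace L] (x y : L) (c : Set.Icc (0 : ℝ) (dist x y) → L) :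
    Prop :=
  Isometry c ∧ c ⟨0, le_refl 0, dist_nonneg⟩ = x ∧ c ⟨dist x y, dist_nonneg, le_refl _⟩ = y

/-- Any two points are joined by exactly one geodesic. -/
def IsUniquelyGeodesic (L : Type u) [MetricSpace L] : Prop :=
  ∀ x y : L, ∃! c : Set.Icc (0 : ℝ) (dist x y) → L, IsGeodesic x y c

/-- Every geodesic of `L` between two points of `L₀` stays in `L₀`. -/
def IsGeodesicallyConvex {L : Type u} [MetricSpace L] (L₀ : Set L) : Prop :=
  ∀ x ∈ L₀, ∀ y ∈ L₀, ∀ c : Set.Icc (0 : ℝ) (dist x y) → L, IsGeodesic x y c → ∀ t, c t ∈ L₀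

/-- The class `FS_q(𝓜)`: metric spaces isometric to nonempty closed geodesically convex subsets of
members of `F_q(𝓜)`. -/
def FSq (q : ℝ) [Fact (1 ≤ q)] (𝓜 : MetricClass.{u}) : MetricClass.{u} := fun X _ =>
  ∃ (L : Type u) (_ : MetricSpace L), Fq q 𝓜 L ∧ ∃ L₀ : Set L,
    L₀.Nonempty ∧ IsClosed L₀ ∧ IsGeodesicallyConvex L₀ ∧ Nonempty (X ≃ᵢ L₀)

/-- The class `ℓ_q(𝓜)` of at most countable pointed `ℓ_q`-products of members of `𝓜`. -/
def ellq (q : ℝ) [Fact (1 ≤ q)] (𝓜 : MetricClass.{u}) : MetricClass.{u} := fun X _ =>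
  ∃ (B : Type) (_ : Nonempty B) (_ : Countable B) (M : B → Type u) (_ : ∀ j, MetricSpace (M j))
    (y : ∀ j, M j), (∀ j, 𝓜 (M j)) ∧
      Nonempty (X ≃ᵢ LqProd q M y (fun _ => ⟨1, Set.mem_Ioi.2 one_pos⟩))

/-! ## Classes of Banach spaces -/

/-- A class of Banach spaces over `𝕜`. -/
def BanachClass (𝕜 : Type) [RCLike 𝕜] : Type (u + 1) :=
  ∀ (E : Type u) [NormedAddCommGroup E] [NormedSpace 𝕜 E] [CompleteSpace E], Prop

/-- The metric spaces underlying (that is, isometric to) the members of a class of Banach spaces. -/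
def BanachClass.toMetricClass {𝕜 : Type} [RCLike 𝕜] (𝓔 : BanachClass.{u} 𝕜) :
    MetricClass.{u} := fun X _ =>
  ∃ (E : Type u) (_ : NormedAddCommGroup E) (_ : NormedSpace 𝕜 E) (_ : CompleteSpace E),
    𝓔 E ∧ Nonempty (X ≃ᵢ E)

section Affine

variable {𝕜 : Type} [RCLike 𝕜] {E : Type u} [NormedAddCommGroup E] [NormedSpace 𝕜 E]
  {q : ℝ}

/-- The affine combination `(1 - c) z + c w` in a finite `ℓ_q`-product of copies of a Banach space,
formed coordinatewise. -/
def FinProd.lineMap {F : Type} [Fintype F] [Nonempty F] {y : F → E} (c : 𝕜)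
    (z w : FinProd q E F y) : FinProd q E F y :=
  ⟨fun j => AffineMap.lineMap (z.1 j) (w.1 j) c, Summable.of_finite⟩

theorem FinProd.lineMap_self {F : Type} [Fintype F] [Nonempty F] {y : F → E} (c : 𝕜)
    (z : FinProd q E F y) : FinProd.lineMap c z z = z :=
  Subtype.ext (funext fun _ => AffineMap.lineMap_same_apply _ _)

variable [Fact (1 ≤ q)]

theorem FinProd.dist_of_scaled {F : Type} [Fintype F] [Nonempty F] {y : F → E} {a : ℝ}
    (ha : 0 ≤ a) {z w z' w' : FinProd q E F y}
    (h : ∀ j, dist (z.1 j) (w.1 j) = a * dist (z'.1 j) (w'.1 j)) :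
    dist z w = a * dist z' w' := by
  have hq : (1 : ℝ) ≤ q := Fact.out
  have hq0 : q ≠ 0 := by linarith
  have hs : ∀ j, ((folnerScale q F : ℝ) * dist (z.1 j) (w.1 j)) ^ q =
      a ^ q * ((folnerScale q F : ℝ) * dist (z'.1 j) (w'.1 j)) ^ q := by
    intro j
    rw [h j, ← Real.mul_rpow ha (mul_nonneg (le_of_lt (folnerScale q F).2) dist_nonneg)]
    congr 1
    ring
  rw [LqProd.dist_def, LqProd.dist_def]
  simp only [hs]
  rw [tsum_mul_left, Real.mul_rpow (Real.rpow_nonneg ha q)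
    (tsum_nonneg fun j => Real.rpow_nonneg
      (mul_nonneg (le_of_lt (folnerScale q F).2) dist_nonneg) q),
    ← Real.rpow_mul ha, mul_one_div_cancel hq0, Real.rpow_one]

theorem FinProd.dist_lineMap_le {F : Type} [Fintype F] [Nonempty F] {y : F → E} (c : 𝕜)
    (z w z' w' : FinProd q E F y) :
    dist (FinProd.lineMap c z w) (FinProd.lineMap c z' w') ≤
      ‖1 - c‖ * dist z z' + ‖c‖ * dist w w' := by
  refine (dist_triangle _ (FinProd.lineMap c z' w) _).trans (add_le_add (le_of_eq ?_) (le_of_eq ?_))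
  · refine FinProd.dist_of_scaled (norm_nonneg _) fun j => ?_
    simp only [FinProd.lineMap, AffineMap.lineMap_apply_module, dist_add_right, dist_smul₀]
  · refine FinProd.dist_of_scaled (norm_nonneg _) fun j => ?_
    simp only [FinProd.lineMap, AffineMap.lineMap_apply_module, dist_add_left, dist_smul₀]

variable {U : Ultrafilter ℕ} {F : ℕ → Type} [∀ m, Fintype (F m)] [∀ m, Nonempty (F m)]
  {y : ∀ m, F m → E}

/-- Affine combinations of bounded sequences, formed termwise. -/
def preLineMap (c : 𝕜)
    (z w : PreUltraproduct U (fun m => FinProd q E (F m) (y m)) (fun _ => LqProd.base)) :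
    PreUltraproduct U (fun m => FinProd q E (F m) (y m)) (fun _ => LqProd.base) :=
  ⟨fun m => FinProd.lineMap c (z.1 m) (w.1 m), by
    obtain ⟨D, hD⟩ := z.2
    obtain ⟨D', hD'⟩ := w.2
    refine ⟨‖1 - c‖ * D + ‖c‖ * D', fun m => ?_⟩
    have h := FinProd.dist_lineMap_le c (z.1 m) (w.1 m) LqProd.base LqProd.base
    rw [FinProd.lineMap_self] at h
    exact h.trans (add_le_add (mul_le_mul_of_nonneg_left (hD m) (norm_nonneg _))
      (mul_le_mul_of_nonneg_left (hD' m) (norm_nonneg _)))⟩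

theorem dist_preLineMap_le (c : 𝕜)
    (z w z' w' : PreUltraproduct U (fun m => FinProd q E (F m) (y m)) (fun _ => LqProd.base)) :
    dist (preLineMap c z w) (preLineMap c z' w') ≤ ‖1 - c‖ * dist z z' + ‖c‖ * dist w w' := by
  refine le_of_tendsto_of_tendsto (PreUltraproduct.tendsto_dist _ _)
    (((PreUltraproduct.tendsto_dist z z').const_mul _).add
      ((PreUltraproduct.tendsto_dist w w').const_mul _)) ?_
  exact Eventually.of_forall fun m => FinProd.dist_lineMap_le c _ _ _ _

/-- The affine combination `(1 - c) z + c w` in an ultraproduct of finite `ℓ_q`-products of copies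
of a Banach space. -/
def FolnerSpace.lineMap (c : 𝕜) :
    FolnerSpace q E U F y → FolnerSpace q E U F y → FolnerSpace q E U F y :=
  SeparationQuotient.lift₂ (fun z w => SeparationQuotient.mk (preLineMap c z w)) <| by
    intro z w z' w' hz hw
    rw [SeparationQuotient.mk_eq_mk, Metric.inseparable_iff]
    refine le_antisymm ((dist_preLineMap_le c z w z' w').trans (le_of_eq ?_)) dist_nonneg
    rw [Metric.inseparable_iff.1 hz, Metric.inseparable_iff.1 hw]
    simp

end Affine

/-- The class `FS_q(𝓔)` for a class `𝓔` of Banach spaces: the Banach spaces that are isometrically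
affinely isomorphic to nonempty closed affine subspaces of members of `F_q(𝓔)`. -/
def FSqBanach (q : ℝ) [Fact (1 ≤ q)] {𝕜 : Type} [RCLike 𝕜] (𝓔 : BanachClass.{u} 𝕜) :
    BanachClass.{u} 𝕜 := fun V _ _ _ =>
  ∃ (E : Type u) (_ : NormedAddCommGroup E) (_ : NormedSpace 𝕜 E) (_ : CompleteSpace E)
    (U : Ultrafilter ℕ) (F : ℕ → Type) (_ : ∀ m, Fintype (F m)) (_ : ∀ m, Nonempty (F m))
    (y : ∀ m, F m → E) (L₀ : Set (FolnerSpace q E U F y)),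
    𝓔 E ∧ IsAdmissible U F ∧ L₀.Nonempty ∧ IsClosed L₀ ∧
      (∀ (c : 𝕜), ∀ z ∈ L₀, ∀ w ∈ L₀, FolnerSpace.lineMap c z w ∈ L₀) ∧
      ∃ φ : V ≃ᵢ L₀, ∀ (c : 𝕜) (v w : V),
        (φ (AffineMap.lineMap v w c) : FolnerSpace q E U F y) = FolnerSpace.lineMap c (φ v) (φ w)

end

/-!
Both directions rest on the fact that convergence in the Cayley topology means agreement of the
Cayley graphs on balls of growing radius (`MarkedGroup.Agree`, `MarkedGroup.tendsto_iff`).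

*From the boundary to the sequence.* By compactness each `G m` agrees, up to a length tending to
infinity, with a member `H m` of the Cayley boundary. The spaces on which the countably many `H m`
act are the factors of one `ℓ_q`-product, and `H m` acts through its own coordinate. A set of small
diameter in the component `m` is translated close to the identity and mapped by the orbit map of
`H m`. Two such trivializations differ by the isometry that belongs to the difference of the two
translations, which does not depend on the point (`hasFibredEmbedding_of_agree`). If the sequence
converges, all `H m` may be taken equal to the limit, and no product is needed.

*From the sequence to the boundary.* Let `H` be the limit of `G n` along a non-principal
ultrafilter. Sections of the fibres are functions `z : G n → M`, when the fibre at `x` is identified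
with `M` by the trivialization over a large ball around `x`, and left translation acts on them:
`(z · g) x` is the value of `z` at `g x`, transported by the transition isometry between the
trivializations around `g x` and around `x`. Compatibility of the trivializations makes this a right
action on larger and larger balls, hence in the limit an action of `H`, and the given section has an
orbit with the given control functions. The functions are restricted to finite subsets of `G n`: the
whole group if it is finite, and a Følner set if it is amenable. In the latter case the translations
are only defined off a set of small density (`AlmostAction`), so the action lives on the regular
part of the ultraproduct: the set of points whose distance to the base point does not concentrate
on sets of density tending to `0`. There it is well defined, and it is isometric since it acts by
`1`-Lipschitz maps that have `1`-Lipschitz inverses (`AlmostAction.exists_action_regularPart`).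

The regular part is closed. It is geodesically convex because a point `u` between regular points
`z` and `w` cannot gain distance to `z` on a set where `z` and `w` are close, without lengthening
the way from `z` to `w` (`isRegular_of_dist_add_dist_le`). Over a Banach space it is an affine
subspace, and it is a Banach space since metric ultraproducts are complete
(`PreUltraproduct.completeSpace`). For finite groups the exceptional sets are empty, and with the
weights `1` in place of densities every point is regular (`regularPart_one`).
-/

noncomputable section

/-! ### Words, word metrics and local agreement of marked groups -/

namespace MarkedGroup

variable {k : ℕ}

theorem proj_eq_proj_iff (G : MarkedGroup k) {v w : FreeGroup (Fin k)} :
    G.proj v = G.proj w ↔ v * w⁻¹ ∈ G.ker := by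
  rw [← mul_inv_eq_one, ← map_inv, ← map_mul]
  exact QuotientGroup.eq_one_iff _

theorem proj_surjective (G : MarkedGroup k) : Function.Surjective G.proj :=
  QuotientGroup.mk'_surjective G.ker

theorem cay_adj_iff (G : MarkedGroup k) {g h : G.Carrier} :
    G.cay.Adj g h ↔ g ≠ h ∧ ∃ a : Fin k × Bool, h = G.proj (FreeGroup.mk [a]) * g := by
  have hinv : ∀ j, G.proj (FreeGroup.mk [(j, false)]) = (G.gen j)⁻¹ := fun j => by
    rw [gen, ← map_inv]; rfl
  have hgen : ∀ j, G.proj (FreeGroup.mk [(j, true)]) = G.gen j := fun j => rfl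
  rw [cay, SimpleGraph.fromRel_adj]
  refine and_congr_right fun _ => ⟨?_, ?_⟩
  · rintro (⟨j, hj⟩ | ⟨j, hj⟩)
    · exact ⟨(j, true), hj⟩
    · exact ⟨(j, false), by rw [hinv, hj, inv_mul_cancel_left]⟩
  · rintro ⟨⟨j, b⟩, h⟩
    cases b
    · exact Or.inr ⟨j, by rw [h, hinv, mul_inv_cancel_left]⟩
    · exact Or.inl ⟨j, h⟩

/-- The path metric of the Cayley graph is the word metric. -/
theorem cay_dist_le_iff (G : MarkedGroup k) {g h : G.Carrier} {N : ℕ} :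
    G.cay.dist g h ≤ N ↔
      ∃ L : List (Fin k × Bool), L.length ≤ N ∧ h = G.proj (FreeGroup.mk L) * g := by
  constructor
  · intro hd
    obtain ⟨p, hp⟩ := G.cay_connected.exists_walk_length_eq_dist g h
    have key : ∀ {a b : G.Carrier} (p : G.cay.Walk a b),
        ∃ L : List (Fin k × Bool), L.length = p.length ∧ b = G.proj (FreeGroup.mk L) * a := by
      intro a b p
      induction p with
      | nil => exact ⟨[], rfl, by rw [← FreeGroup.one_eq_mk, map_one, one_mul]⟩
      | cons hadj p ih =>
        obtain ⟨L, hL, hb⟩ := ih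
        obtain ⟨-, x, hx⟩ := G.cay_adj_iff.1 hadj
        exact ⟨L ++ [x], by simp [hL], by
          rw [← FreeGroup.mul_mk, map_mul, mul_assoc, ← hx, ← hb]⟩
    obtain ⟨L, hL, hb⟩ := key p
    exact ⟨L, by omega, hb⟩
  · rintro ⟨L, hL, rfl⟩
    refine le_trans ?_ hL
    clear hL
    induction L with
    | nil => rw [← FreeGroup.one_eq_mk, map_one, one_mul]; simp
    | cons x L ih =>
      have h1 : G.proj (FreeGroup.mk (x :: L)) * g =
          G.proj (FreeGroup.mk [x]) * (G.proj (FreeGroup.mk L) * g) := by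
        rw [← mul_assoc, ← map_mul, FreeGroup.mul_mk]; rfl
      have h2 : G.cay.dist (G.proj (FreeGroup.mk L) * g)
          (G.proj (FreeGroup.mk [x]) * (G.proj (FreeGroup.mk L) * g)) ≤ 1 := by
        by_cases he : G.proj (FreeGroup.mk L) * g =
            G.proj (FreeGroup.mk [x]) * (G.proj (FreeGroup.mk L) * g)
        · rw [← he]; simp
        · exact (SimpleGraph.dist_eq_one_iff_adj.2 (G.cay_adj_iff.2 ⟨he, x, rfl⟩)).le
      rw [h1]
      refine (G.cay_connected.dist_triangle (v := G.proj (FreeGroup.mk L) * g)).trans ?_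
      simp only [List.length_cons]
      omega

theorem dist_eq_cay_dist (G : MarkedGroup k) (g h : G.Carrier) :
    dist g h = (G.cay.dist g h : ℝ) := rfl

theorem cay_dist_mul_right (G : MarkedGroup k) (g h x : G.Carrier) :
    G.cay.dist (g * x) (h * x) = G.cay.dist g h := by
  refine eq_of_forall_ge_iff fun N => ?_
  rw [cay_dist_le_iff, cay_dist_le_iff]
  simp only [← mul_assoc, mul_left_inj]

theorem nndist_mul_right (G : MarkedGroup k) (g h x : G.Carrier) :
    nndist (g * x) (h * x) = nndist g h := by
  refine NNReal.eq ?_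
  rw [coe_nndist, coe_nndist, dist_eq_cay_dist, dist_eq_cay_dist, cay_dist_mul_right]

/-- A word of minimal length that represents a given element. -/
theorem exists_word (G : MarkedGroup k) (g : G.Carrier) :
    ∃ L : List (Fin k × Bool), L.length ≤ G.cay.dist 1 g ∧ G.proj (FreeGroup.mk L) = g := by
  obtain ⟨L, hL, h⟩ := G.cay_dist_le_iff.1 (le_refl (G.cay.dist 1 g))
  exact ⟨L, hL, by rw [h, mul_one]⟩

/-- Two marked groups agree up to length `N` if the same words of length at most `N` are trivial in
both, so that balls in their Cayley graphs of radius about `N / 2` are isomorphic. -/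
def Agree (N : ℕ) (G H : MarkedGroup k) : Prop :=
  ∀ L : List (Fin k × Bool), L.length ≤ N → (FreeGroup.mk L ∈ G.ker ↔ FreeGroup.mk L ∈ H.ker)

namespace Agree

variable {G H : MarkedGroup k} {N : ℕ}

theorem symm (h : Agree N G H) : Agree N H G := fun L hL => (h L hL).symm

theorem mono (h : Agree N G H) {N' : ℕ} (hN : N' ≤ N) : Agree N' G H :=
  fun L hL => h L (hL.trans hN)

theorem proj_eq_iff (h : Agree N G H) {L₁ L₂ : List (Fin k × Bool)}
    (hL : L₁.length + L₂.length ≤ N) :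
    G.proj (FreeGroup.mk L₁) = G.proj (FreeGroup.mk L₂) ↔
      H.proj (FreeGroup.mk L₁) = H.proj (FreeGroup.mk L₂) := by
  rw [proj_eq_proj_iff, proj_eq_proj_iff, FreeGroup.inv_mk, FreeGroup.mul_mk]
  exact h _ (by simpa using hL)

theorem cay_dist_le (h : Agree N G H) {L₁ L₂ : List (Fin k × Bool)}
    (hL : 2 * (L₁.length + L₂.length) ≤ N) :
    H.cay.dist (H.proj (FreeGroup.mk L₁)) (H.proj (FreeGroup.mk L₂)) ≤
      G.cay.dist (G.proj (FreeGroup.mk L₁)) (G.proj (FreeGroup.mk L₂)) := by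
  have h0 : G.cay.dist (G.proj (FreeGroup.mk L₁)) (G.proj (FreeGroup.mk L₂)) ≤
      L₁.length + L₂.length := by
    refine G.cay_dist_le_iff.2 ⟨L₂ ++ FreeGroup.invRev L₁, by simp [add_comm], ?_⟩
    rw [← FreeGroup.mul_mk, ← FreeGroup.inv_mk, ← map_mul, inv_mul_cancel_right]
  obtain ⟨L, hLl, hLe⟩ := G.cay_dist_le_iff.1 (le_refl
    (G.cay.dist (G.proj (FreeGroup.mk L₁)) (G.proj (FreeGroup.mk L₂))))
  refine H.cay_dist_le_iff.2 ⟨L, hLl, ?_⟩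
  rw [← map_mul, FreeGroup.mul_mk] at hLe ⊢
  refine (h.proj_eq_iff ?_).1 hLe
  rw [List.length_append]
  omega

theorem nndist_eq (h : Agree N G H) {L₁ L₂ : List (Fin k × Bool)}
    (hL : 2 * (L₁.length + L₂.length) ≤ N) :
    nndist (G.proj (FreeGroup.mk L₁)) (G.proj (FreeGroup.mk L₂)) =
      nndist (H.proj (FreeGroup.mk L₁)) (H.proj (FreeGroup.mk L₂)) := by
  refine NNReal.eq ?_
  rw [coe_nndist, coe_nndist, dist_eq_cay_dist, dist_eq_cay_dist,
    le_antisymm (h.symm.cay_dist_le hL) (h.cay_dist_le hL)]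

end Agree

/-! ### Convergence in the Cayley topology -/

theorem tendsto_iff {ι : Type*} {l : Filter ι} {G : ι → MarkedGroup k} {H : MarkedGroup k} :
    Tendsto G l (𝓝 H) ↔ ∀ w, ∀ᶠ n in l, (w ∈ (G n).ker ↔ w ∈ H.ker) := by
  have hind : IsInducing (code : MarkedGroup k → FreeGroup (Fin k) → Bool) := ⟨rfl⟩
  rw [hind.tendsto_nhds_iff, tendsto_pi_nhds]
  refine forall_congr' fun w => ?_
  rw [nhds_discrete, tendsto_pure]
  refine eventually_congr (Eventually.of_forall fun n => ?_)
  simp [code]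

theorem eventually_agree {ι : Type*} {l : Filter ι} {G : ι → MarkedGroup k} {H : MarkedGroup k}
    (h : Tendsto G l (𝓝 H)) (N : ℕ) : ∀ᶠ n in l, Agree N (G n) H := by
  have hfin : {L : List (Fin k × Bool) | L.length ≤ N}.Finite := List.finite_length_le _ _
  exact (eventually_all_finite hfin).2 fun L _ => tendsto_iff.1 h (FreeGroup.mk L)

/-- Compactness of the space of marked groups: the words that are trivial almost everywhere form
a normal subgroup, and the corresponding marked group is the limit. -/
theorem exists_tendsto_ultrafilter {ι : Type*} (V : Ultrafilter ι) (G : ι → MarkedGroup k) :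
    ∃ H : MarkedGroup k, Tendsto G V (𝓝 H) := by
  let K : Subgroup (FreeGroup (Fin k)) :=
    { carrier := {w | ∀ᶠ n in V, w ∈ (G n).ker}
      one_mem' := Eventually.of_forall fun n => one_mem _
      mul_mem' := fun ha hb => by
        filter_upwards [ha, hb] with n h1 h2 using mul_mem h1 h2
      inv_mem' := fun ha => by
        filter_upwards [ha] with n h1 using inv_mem h1 }
  have hK : ∀ w, w ∈ K ↔ ∀ᶠ n in V, w ∈ (G n).ker := fun w => Iff.rfl
  refine ⟨⟨K, ⟨fun w hw g => ?_⟩⟩, tendsto_iff.2 fun w => ?_⟩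
  · rw [hK] at hw ⊢
    filter_upwards [hw] with n h1 using (G n).normal.conj_mem _ h1 g
  · by_cases hw : w ∈ K
    · filter_upwards [(hK w).1 hw] with n h1 using iff_of_true h1 hw
    · filter_upwards [Ultrafilter.eventually_not.2 (mt (hK w).2 hw)] with n h1
      exact iff_of_false h1 hw

/-- The terms of a sequence of marked groups approach its Cayley boundary. -/
theorem eventually_exists_mem_cayleyBoundary_agree (G : ℕ → MarkedGroup k) (N : ℕ) :
    ∀ᶠ m in atTop, ∃ H ∈ cayleyBoundary G, Agree N (G m) H := by
  by_contra hcon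
  rw [not_eventually] at hcon
  have hne : (atTop ⊓ 𝓟 {m | ¬∃ H ∈ cayleyBoundary G, Agree N (G m) H}).NeBot :=
    frequently_mem_iff_neBot.1 hcon
  obtain ⟨V, hV⟩ := Ultrafilter.exists_le (atTop ⊓ 𝓟 {m | ¬∃ H ∈ cayleyBoundary G,
    Agree N (G m) H})
  obtain ⟨H, hH⟩ := exists_tendsto_ultrafilter V G
  have hmem : H ∈ cayleyBoundary G :=
    mapClusterPt_iff_ultrafilter.2 ⟨V, hV.trans inf_le_left, hH⟩
  have hbad : ∀ᶠ m in V, ¬∃ H ∈ cayleyBoundary G, Agree N (G m) H :=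
    hV (mem_inf_of_right (mem_principal_self _))
  obtain ⟨m, h1, h2⟩ := (hbad.and (eventually_agree hH N)).exists
  exact h1 ⟨H, hmem, h2⟩

end MarkedGroup

/-- A diagonal argument: if each of countably many properties holds eventually, then one whose index
tends to infinity holds eventually. -/
theorem exists_tendsto_atTop_of_eventually {P : ℕ → ℕ → Prop} {l : Filter ℕ} (hl : l ≤ atTop)
    (h : ∀ N, ∀ᶠ m in l, P N m) : ∃ N : ℕ → ℕ, Tendsto N l atTop ∧ ∀ᶠ m in l, P (N m) m := by
  classical
  refine ⟨fun m => Nat.findGreatest (fun N => P N m) m, ?_, ?_⟩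
  · refine tendsto_atTop.2 fun b => ?_
    filter_upwards [h b, hl (eventually_ge_atTop b)] with m h1 h2 using Nat.le_findGreatest h2 h1
  · filter_upwards [h 0] with m h1
    exact Nat.findGreatest_spec (P := fun N => P N m) (Nat.zero_le m) h1

/-! ### Disjoint unions and sets of small diameter -/

namespace DisjointUnion

variable {X : ℕ → Type v} [∀ m, MetricSpace (X m)]

theorem edist_mk {m : ℕ} (a b : X m) :
    @edist (DisjointUnion X) _ ⟨m, a⟩ ⟨m, b⟩ = edist a b := by
  change (if h : m = m then edist (h ▸ a : X m) b else ⊤) = _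
  simp

theorem fst_eq_of_edist_ne_top {x y : DisjointUnion X} (h : edist x y ≠ ⊤) : x.1 = y.1 := by
  by_contra hne
  refine h ?_
  change (if h : x.1 = y.1 then edist (h ▸ x.2 : X y.1) y.2 else ⊤) = _
  simp [hne]

theorem toNNReal_edist_mk {m : ℕ} (a b : X m) :
    (@edist (DisjointUnion X) _ ⟨m, a⟩ ⟨m, b⟩).toNNReal = nndist a b := by
  rw [edist_mk, edist_nndist, ENNReal.toNNReal_coe]

end DisjointUnion

namespace IsSmallBeyond

variable {X : ℕ → Type v} [∀ m, MetricSpace (X m)] {m₀ : ℕ} {R : ℝ≥0} {C : Set (DisjointUnion X)}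

theorem edist_le (h : IsSmallBeyond m₀ R C) {x y : DisjointUnion X} (hx : x ∈ C) (hy : y ∈ C) :
    edist x y ≤ R :=
  (Metric.edist_le_ediam_of_mem hx hy).trans h.2.2

theorem fst_eq (h : IsSmallBeyond m₀ R C) {x y : DisjointUnion X} (hx : x ∈ C) (hy : y ∈ C) :
    x.1 = y.1 :=
  DisjointUnion.fst_eq_of_edist_ne_top
    ((h.edist_le hx hy).trans_lt ENNReal.coe_lt_top).ne

theorem nndist_le (h : IsSmallBeyond m₀ R C) {m : ℕ} {a b : X m}
    (ha : (⟨m, a⟩ : DisjointUnion X) ∈ C) (hb : (⟨m, b⟩ : DisjointUnion X) ∈ C) :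
    nndist a b ≤ R := by
  have := h.edist_le ha hb
  rw [DisjointUnion.edist_mk, edist_nndist] at this
  exact_mod_cast this

end IsSmallBeyond

/-! ### From the Cayley boundary to fibred coarse embeddings -/

namespace MarkedGroup

variable {k : ℕ}

/-- A word of minimal length that represents the element `g`. -/
def word (G : MarkedGroup k) (g : G.Carrier) : List (Fin k × Bool) := (G.exists_word g).choose

theorem length_word_le (G : MarkedGroup k) (g : G.Carrier) :
    (G.word g).length ≤ G.cay.dist 1 g := (G.exists_word g).choose_spec.1

theorem proj_word (G : MarkedGroup k) (g : G.Carrier) : G.proj (FreeGroup.mk (G.word g)) = g :=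
  (G.exists_word g).choose_spec.2

theorem length_word_mul_inv_le (G : MarkedGroup k) {g h : G.Carrier} {R : ℝ≥0} {N : ℕ}
    (hN : R ≤ N) (hR : nndist g h ≤ R) : (G.word (g * h⁻¹)).length ≤ N := by
  refine (G.length_word_le _).trans ?_
  rw [← G.cay_dist_mul_right _ _ h, one_mul, inv_mul_cancel_right, SimpleGraph.dist_comm]
  have h1 : ((G.cay.dist g h : ℝ)) ≤ N := by
    rw [← dist_eq_cay_dist, ← coe_nndist]
    exact_mod_cast hR.trans hN
  exact_mod_cast h1

/-- The element of `H` that corresponds to `g ∈ G`, when `G` and `H` agree up to a length that is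
large compared to `g`. -/
def transfer (G H : MarkedGroup k) (g : G.Carrier) : H.Carrier :=
  H.proj (FreeGroup.mk (G.word g))

theorem nndist_transfer {G H : MarkedGroup k} {N : ℕ} (hA : Agree (4 * N) G H) {g h : G.Carrier}
    (hg : (G.word g).length ≤ N) (hh : (G.word h).length ≤ N) :
    nndist (transfer G H g) (transfer G H h) = nndist g h := by
  rw [transfer, transfer, ← hA.nndist_eq (by omega), proj_word, proj_word]

theorem inv_transfer_mul_transfer_eq {G H : MarkedGroup k} {N : ℕ} (hA : Agree (4 * N) G H)
    {g h g' h' : G.Carrier} (hg : (G.word g).length ≤ N) (hh : (G.word h).length ≤ N)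
    (hg' : (G.word g').length ≤ N) (hh' : (G.word h').length ≤ N) (heq : h⁻¹ * g = h'⁻¹ * g') :
    (transfer G H h)⁻¹ * transfer G H g = (transfer G H h')⁻¹ * transfer G H g' := by
  have key : ∀ K : MarkedGroup k, ∀ L₁ L₂ : List (Fin k × Bool),
      (K.proj (FreeGroup.mk L₂))⁻¹ * K.proj (FreeGroup.mk L₁) =
        K.proj (FreeGroup.mk (FreeGroup.invRev L₂ ++ L₁)) := fun K L₁ L₂ => by
    rw [← FreeGroup.mul_mk, map_mul, ← FreeGroup.inv_mk, map_inv]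
  rw [transfer, transfer, transfer, transfer, key, key]
  refine (hA.proj_eq_iff ?_).1 ?_
  · simp only [List.length_append, FreeGroup.invRev_length]
    omega
  · rw [← key, ← key, proj_word, proj_word, proj_word, proj_word, heq]

end MarkedGroup

open Classical in
/-- A point of the component `m` of a set, with a junk value if there is none. -/
def pointIn {k : ℕ} {G : ℕ → MarkedGroup k} (C : Set (DisjointUnion fun m => (G m).Carrier))
    (m : ℕ) : (G m).Carrier :=
  if h : ∃ g, (⟨m, g⟩ : DisjointUnion fun m => (G m).Carrier) ∈ C then h.choose else 1

theorem pointIn_mem {k : ℕ} {G : ℕ → MarkedGroup k}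
    {C : Set (DisjointUnion fun m => (G m).Carrier)} {m : ℕ} {g : (G m).Carrier}
    (hg : (⟨m, g⟩ : DisjointUnion fun m => (G m).Carrier) ∈ C) :
    (⟨m, pointIn C m⟩ : DisjointUnion fun m => (G m).Carrier) ∈ C := by
  have h : ∃ g, (⟨m, g⟩ : DisjointUnion fun m => (G m).Carrier) ∈ C := ⟨g, hg⟩
  rw [pointIn, dif_pos h]
  exact h.choose_spec

/-- If marked groups `H m`, approximating the `G m` up to lengths that tend to infinity, act on one
pointed space with a common control pair, then the `G m` admit a fibred coarse embedding into that
space. All fibres are the space itself, and over a small set `C` in the component `m` the orbit of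
`H m` serves as trivialization, after the translation of a chosen point of `C` to the identity. -/
theorem hasFibredEmbedding_of_agree {k : ℕ} {ρ ω : ℝ≥0 → ℝ≥0} {G H : ℕ → MarkedGroup k}
    (hGH : ∀ N, ∀ᶠ m in atTop, MarkedGroup.Agree N (G m) (H m))
    (M : Type u) [MetricSpace M] (α : ∀ m, ((H m).Carrier)ᵐᵒᵖ →* (M ≃ᵢ M)) (y : M)
    (hα : ∀ m, ∀ g h : (H m).Carrier,
      ρ (nndist g h) ≤ nndist (α m (MulOpposite.op g) y) (α m (MulOpposite.op h) y) ∧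
        nndist (α m (MulOpposite.op g) y) (α m (MulOpposite.op h) y) ≤ ω (nndist g h)) :
    HasFibredEmbedding ρ ω (fun m => (G m).Carrier) M := by
  refine ⟨fun _ => M, fun _ => inferInstance, fun _ => ⟨IsometryEquiv.refl M⟩, fun _ => y,
    fun R => ?_⟩
  obtain ⟨N, hN⟩ := exists_nat_ge R
  obtain ⟨m₁, hm₁⟩ := eventually_atTop.1 (hGH (4 * N))
  refine ⟨m₁ + 1, by omega, fun C x => α x.1 (MulOpposite.op
    (MarkedGroup.transfer (G x.1) (H x.1) (x.2 * (pointIn C x.1)⁻¹))), ?_, ?_⟩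
  · rintro C hC ⟨m, a⟩ ha ⟨m', b⟩ hb
    obtain rfl : m = m' := hC.fst_eq ha hb
    have hA := hm₁ m ((Nat.le_succ _).trans (hC.2.1 _ ha))
    have hp := pointIn_mem ha
    have h1 := (G m).length_word_mul_inv_le hN (hC.nndist_le ha hp)
    have h2 := (G m).length_word_mul_inv_le hN (hC.nndist_le hb hp)
    have h3 := hα m (MarkedGroup.transfer (G m) (H m) (a * (pointIn C m)⁻¹))
      (MarkedGroup.transfer (G m) (H m) (b * (pointIn C m)⁻¹))
    rw [MarkedGroup.nndist_transfer hA h1 h2, MarkedGroup.nndist_mul_right] at h3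
    rwa [DisjointUnion.toNNReal_edist_mk]
  · rintro C₁ C₂ hC₁ hC₂ ⟨⟨m, a⟩, ha₁, ha₂⟩
    refine ⟨α m (MulOpposite.op ((MarkedGroup.transfer (G m) (H m) (a * (pointIn C₂ m)⁻¹))⁻¹ *
      MarkedGroup.transfer (G m) (H m) (a * (pointIn C₁ m)⁻¹))), ?_⟩
    rintro ⟨m', b⟩ ⟨hb₁, hb₂⟩
    obtain rfl : m = m' := hC₁.fst_eq ha₁ hb₁
    have hA := hm₁ m ((Nat.le_succ _).trans (hC₁.2.1 _ ha₁))
    have hp₁ := pointIn_mem ha₁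
    have hp₂ := pointIn_mem ha₂
    have hlen : ∀ c : (G m).Carrier,
        (⟨m, c⟩ : DisjointUnion fun m => (G m).Carrier) ∈ C₁ →
        (⟨m, c⟩ : DisjointUnion fun m => (G m).Carrier) ∈ C₂ →
        ((G m).word (c * (pointIn C₁ m)⁻¹)).length ≤ N ∧
          ((G m).word (c * (pointIn C₂ m)⁻¹)).length ≤ N := fun c h₁ h₂ =>
      ⟨(G m).length_word_mul_inv_le hN (hC₁.nndist_le h₁ hp₁),
        (G m).length_word_mul_inv_le hN (hC₂.nndist_le h₂ hp₂)⟩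
    -- The transition isometry does not depend on the point, since `x` cancels in
    -- `(x * x₂⁻¹)⁻¹ * (x * x₁⁻¹)`.
    have hkey := MarkedGroup.inv_transfer_mul_transfer_eq hA (hlen b hb₁ hb₂).1
      (hlen b hb₁ hb₂).2 (hlen a ha₁ ha₂).1 (hlen a ha₁ ha₂).2 (by group)
    change (α m _)⁻¹.trans (α m _) = α m (MulOpposite.op
      ((MarkedGroup.transfer (G m) (H m) (a * (pointIn C₂ m)⁻¹))⁻¹ *
        MarkedGroup.transfer (G m) (H m) (a * (pointIn C₁ m)⁻¹)))
    rw [← hkey, MulOpposite.op_mul, MulOpposite.op_inv, map_mul, map_inv]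
    rfl

namespace LqProd

variable {q : ℝ} {B : Type v} {M : B → Type u} [∀ j, MetricSpace (M j)] {y : ∀ j, M j}
  {r : B → Set.Ioi (0 : ℝ)}

open Classical in
/-- A self-isometry of one factor, applied to the corresponding coordinate. -/
def updateFun (i : B) (e : M i → M i) (z : LqProd q M y r) : LqProd q M y r :=
  ⟨Function.update z.1 i (e (z.1 i)), by
    refine z.2.congr_cofinite ?_
    filter_upwards [(Set.finite_singleton i).compl_mem_cofinite] with j hj
    rw [Function.update_of_ne hj]⟩

theorem updateFun_apply_self (i : B) (e : M i → M i) (z : LqProd q M y r) :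
    (updateFun i e z).1 i = e (z.1 i) := by
  simp [updateFun]

theorem updateFun_apply_of_ne {i j : B} (h : j ≠ i) (e : M i → M i) (z : LqProd q M y r) :
    (updateFun i e z).1 j = z.1 j := by
  simp [updateFun, h]

theorem updateFun_comp (i : B) (e e' : M i → M i) (z : LqProd q M y r) :
    updateFun i (e ∘ e') z = updateFun i e (updateFun i e' z) := by
  refine Subtype.ext (funext fun j => ?_)
  by_cases h : j = i
  · subst h; simp [updateFun_apply_self]
  · simp [updateFun_apply_of_ne h]

theorem updateFun_id (i : B) (z : LqProd q M y r) : updateFun i id z = z := by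
  refine Subtype.ext (funext fun j => ?_)
  by_cases h : j = i
  · subst h; simp [updateFun_apply_self]
  · simp [updateFun_apply_of_ne h]

variable [Fact (1 ≤ q)]

theorem isometry_updateFun (i : B) {e : M i → M i} (he : Isometry e) :
    Isometry (updateFun i e : LqProd q M y r → LqProd q M y r) := by
  refine Isometry.of_dist_eq fun z w => ?_
  rw [dist_def, dist_def]
  congr 2
  funext j
  by_cases h : j = i
  · subst h; simp [updateFun_apply_self, he.dist_eq]
  · simp [updateFun_apply_of_ne h]

/-- The isometries of one factor act on the product, through the corresponding coordinate. -/
def coordAction (i : B) : (M i ≃ᵢ M i) →* (LqProd q M y r ≃ᵢ LqProd q M y r) where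
  toFun e :=
    { toFun := updateFun i e
      invFun := updateFun i e.symm
      left_inv := fun z => by
        rw [← updateFun_comp, IsometryEquiv.symm_comp_self, updateFun_id]
      right_inv := fun z => by
        rw [← updateFun_comp, IsometryEquiv.self_comp_symm, updateFun_id]
      isometry_toFun := isometry_updateFun i e.isometry }
  map_one' := IsometryEquiv.ext fun z => updateFun_id i z
  map_mul' e e' := IsometryEquiv.ext fun z => updateFun_comp i e e' z

theorem dist_coordAction (i : B) (e e' : M i ≃ᵢ M i) (z : LqProd q M y r) :
    dist (coordAction i e z) (coordAction i e' z) =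
      (r i : ℝ) * dist (e (z.1 i)) (e' (z.1 i)) := by
  have hq : (1 : ℝ) ≤ q := Fact.out
  have hq0 : q ≠ 0 := by linarith
  change dist (updateFun i e z) (updateFun i e' z) = _
  rw [dist_def, tsum_eq_single i, updateFun_apply_self, updateFun_apply_self,
    ← Real.rpow_mul (mul_nonneg (le_of_lt (r i).2) dist_nonneg), mul_one_div_cancel hq0,
    Real.rpow_one]
  intro j hj
  rw [updateFun_apply_of_ne hj, updateFun_apply_of_ne hj, dist_self, mul_zero,
    Real.zero_rpow hq0]

end LqProd

theorem equivariantCP_subset_fibredCP {k : ℕ} {𝓜 : MetricClass.{u}} {G : ℕ → MarkedGroup k}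
    {Ginf : MarkedGroup k} (h : Tendsto G atTop (𝓝 Ginf)) :
    equivariantCP 𝓜 Ginf ⊆ fibredCP 𝓜 G := by
  rintro p ⟨h1, h2, M, _, hM, α, y, hα⟩
  exact ⟨h1, h2, M, inferInstance, hM, hasFibredEmbedding_of_agree (H := fun _ => Ginf)
    (fun N => MarkedGroup.eventually_agree h N) M (fun _ => α) y fun _ => hα⟩

/-- Each `G m` is approximated by a member `H m` of the Cayley boundary, as well as possible. The
spaces on which the `H m` act are the factors of one `ℓ_q`-product, on which `H m` acts through the
coordinate `m`. -/
theorem iInter_equivariantCP_subset_fibredCP_ellq {k : ℕ} (𝓜 : MetricClass.{u})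
    (G : ℕ → MarkedGroup k) (q : ℝ) [Fact (1 ≤ q)] :
    (⋂ H ∈ cayleyBoundary G, equivariantCP 𝓜 H) ⊆ fibredCP (ellq q 𝓜) G := by
  intro p hp
  rw [Set.mem_iInter₂] at hp
  obtain ⟨N, hN, hNG⟩ := exists_tendsto_atTop_of_eventually le_rfl
    (MarkedGroup.eventually_exists_mem_cayleyBoundary_agree G)
  obtain ⟨m₁, H₁, hH₁, -⟩ := hNG.exists
  have hex : ∀ m, ∃ H ∈ cayleyBoundary G,
      (∃ H ∈ cayleyBoundary G, MarkedGroup.Agree (N m) (G m) H) →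
        MarkedGroup.Agree (N m) (G m) H := by
    intro m
    by_cases h : ∃ H ∈ cayleyBoundary G, MarkedGroup.Agree (N m) (G m) H
    · obtain ⟨H, h1, h2⟩ := h
      exact ⟨H, h1, fun _ => h2⟩
    · exact ⟨H₁, hH₁, fun h' => absurd h' h⟩
  choose H hHmem hHagree using hex
  have hGH : ∀ n, ∀ᶠ m in atTop, MarkedGroup.Agree n (G m) (H m) := by
    intro n
    filter_upwards [hNG, hN.eventually_ge_atTop n] with m h1 h2 using (hHagree m h1).mono h2
  choose M inst hM α y hα using fun m => (hp (H m) (hHmem m)).2.2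
  refine ⟨(hp H₁ hH₁).1, (hp H₁ hH₁).2.1,
    LqProd q M y (fun _ => ⟨1, Set.mem_Ioi.2 one_pos⟩), inferInstance,
    ⟨ℕ, inferInstance, inferInstance, M, inst, y, hM, ⟨IsometryEquiv.refl _⟩⟩,
    hasFibredEmbedding_of_agree hGH _ (fun m => (LqProd.coordAction m).comp (α m)) LqProd.base
      fun m g h => ?_⟩
  have hd : nndist (LqProd.coordAction m (α m (MulOpposite.op g))
        (LqProd.base : LqProd q M y (fun _ => ⟨1, Set.mem_Ioi.2 one_pos⟩)))
      (LqProd.coordAction m (α m (MulOpposite.op h)) LqProd.base) =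
      nndist (α m (MulOpposite.op g) (y m)) (α m (MulOpposite.op h) (y m)) := by
    refine NNReal.eq ?_
    rw [coe_nndist, coe_nndist, LqProd.dist_coordAction]
    exact one_mul _
  simp only [MonoidHom.comp_apply]
  rw [hd]
  exact hα m g h

/-! ### Partial distances in finite products -/

/-- The `ℓ_q`-distance of two points of a finite product, on the coordinates in `A` only. -/
def partDist (q : ℝ) {M : Type u} [MetricSpace M] {F : Type} [Fintype F] [Nonempty F]
    (A : Finset F) (z w : F → M) : ℝ :=
  (∑ x ∈ A, ((folnerScale q F : ℝ) * dist (z x) (w x)) ^ q) ^ (1 / q)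

section PartDist

variable {q : ℝ} {M : Type u} [MetricSpace M] {F : Type} [Fintype F] [Nonempty F]

theorem folnerScale_pos : (0 : ℝ) < folnerScale q F := (folnerScale q F).2

theorem folnerScale_mul_dist_nonneg (z w : F → M) (x : F) :
    0 ≤ (folnerScale q F : ℝ) * dist (z x) (w x) :=
  mul_nonneg folnerScale_pos.le dist_nonneg

theorem sum_rpow_nonneg (A : Finset F) (z w : F → M) :
    0 ≤ ∑ x ∈ A, ((folnerScale q F : ℝ) * dist (z x) (w x)) ^ q :=
  Finset.sum_nonneg fun x _ => Real.rpow_nonneg (folnerScale_mul_dist_nonneg z w x) q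

theorem partDist_nonneg (A : Finset F) (z w : F → M) : 0 ≤ partDist q A z w :=
  Real.rpow_nonneg (sum_rpow_nonneg A z w) _

theorem partDist_comm (A : Finset F) (z w : F → M) : partDist q A z w = partDist q A w z := by
  simp only [partDist, dist_comm]

theorem partDist_congr {A : Finset F} {z w z' w' : F → M}
    (h : ∀ x ∈ A, dist (z x) (w x) = dist (z' x) (w' x)) :
    partDist q A z w = partDist q A z' w' := by
  unfold partDist
  rw [Finset.sum_congr rfl fun x hx => by rw [h x hx]]

theorem partDist_image [DecidableEq F] {A : Finset F} {σ : F → F} (hσ : Set.InjOn σ A)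
    {z w z' w' : F → M} (h : ∀ x ∈ A, dist (z' x) (w' x) = dist (z (σ x)) (w (σ x))) :
    partDist q A z' w' = partDist q (A.image σ) z w := by
  rw [partDist, partDist, Finset.sum_image hσ, Finset.sum_congr rfl fun x hx => by rw [h x hx]]

variable [hq1 : Fact (1 ≤ q)]

theorem exponent_pos {q : ℝ} [hq1 : Fact (1 ≤ q)] : 0 < q := zero_lt_one.trans_le hq1.out

theorem partDist_rpow (A : Finset F) (z w : F → M) :
    partDist q A z w ^ q = ∑ x ∈ A, ((folnerScale q F : ℝ) * dist (z x) (w x)) ^ q := by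
  rw [partDist, ← Real.rpow_mul (sum_rpow_nonneg A z w), one_div_mul_cancel
    (exponent_pos (q := q)).ne', Real.rpow_one]

theorem dist_eq_partDist {y : F → M} (z w : FinProd q M F y) :
    dist z w = partDist q Finset.univ z.1 w.1 := by
  rw [LqProd.dist_def, tsum_fintype, partDist]

/-- A point of a finite product, given by its coordinates. -/
def FinProd.ofFun {y : F → M} (z : F → M) : FinProd q M F y := ⟨z, Summable.of_finite⟩

theorem FinProd.dist_ofFun_base {y : F → M} (z : F → M) :
    dist (FinProd.ofFun z : FinProd q M F y) LqProd.base = partDist q Finset.univ z y :=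
  dist_eq_partDist _ _

theorem partDist_triangle (A : Finset F) (z w v : F → M) :
    partDist q A z v ≤ partDist q A z w + partDist q A w v := by
  refine le_trans (Real.rpow_le_rpow (sum_rpow_nonneg A z v)
    (Finset.sum_le_sum fun x _ => ?_) (one_div_nonneg.2 (exponent_pos (q := q)).le))
    (Real.Lp_add_le_of_nonneg A hq1.out (fun x _ => folnerScale_mul_dist_nonneg (q := q) z w x)
      (fun x _ => folnerScale_mul_dist_nonneg (q := q) w v x))
  refine Real.rpow_le_rpow (folnerScale_mul_dist_nonneg z v x) ?_ (exponent_pos (q := q)).le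
  rw [← mul_add]
  exact mul_le_mul_of_nonneg_left (dist_triangle _ _ _) folnerScale_pos.le

theorem partDist_mono {A B : Finset F} (h : A ⊆ B) (z w : F → M) :
    partDist q A z w ≤ partDist q B z w :=
  Real.rpow_le_rpow (sum_rpow_nonneg A z w) (Finset.sum_le_sum_of_subset_of_nonneg h
    fun x _ _ => Real.rpow_nonneg (folnerScale_mul_dist_nonneg z w x) q)
    (one_div_nonneg.2 (exponent_pos (q := q)).le)

theorem partDist_eq_zero {A : Finset F} {z w : F → M} (h : ∀ x ∈ A, z x = w x) :
    partDist q A z w = 0 := by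
  have hq := exponent_pos (q := q)
  rw [partDist, Finset.sum_eq_zero, Real.zero_rpow (one_div_pos.2 hq).ne']
  intro x hx
  rw [h x hx, dist_self, mul_zero, Real.zero_rpow hq.ne']

theorem partDist_univ_le_add [DecidableEq F] (A : Finset F) (z w : F → M) :
    partDist q Finset.univ z w ≤ partDist q Aᶜ z w + partDist q A z w := by
  have hq := exponent_pos (q := q)
  rw [partDist, ← Finset.sum_compl_add_sum A]
  refine Real.rpow_add_le_add_rpow (sum_rpow_nonneg _ z w) (sum_rpow_nonneg _ z w)
    (one_div_nonneg.2 hq.le) ?_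
  rw [div_le_one hq]
  exact hq1.out

theorem partDist_univ_rpow [DecidableEq F] (A : Finset F) (z w : F → M) :
    partDist q Finset.univ z w ^ q = partDist q Aᶜ z w ^ q + partDist q A z w ^ q := by
  rw [partDist_rpow, partDist_rpow, partDist_rpow, Finset.sum_compl_add_sum]

/-- The `ℓ_q`-distance on `A` of functions at constant distance: the scaling factor makes it the
density of `A`, to the power `1 / q`, times the constant. -/
theorem sum_const_rpow (A : Finset F) {D : ℝ} (hD : 0 ≤ D) :
    (∑ _x ∈ A, ((folnerScale q F : ℝ) * D) ^ q) ^ (1 / q) =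
      D * ((A.card : ℝ) / Fintype.card F) ^ (1 / q) := by
  have hq := exponent_pos (q := q)
  have hc : (0 : ℝ) ≤ Fintype.card F := Nat.cast_nonneg _
  have hs : ((folnerScale q F : ℝ) * D) ^ q = D ^ q * (1 / Fintype.card F) := by
    rw [Real.mul_rpow folnerScale_pos.le hD, mul_comm, folnerScale]
    simp only
    rw [Real.div_rpow zero_le_one (Real.rpow_nonneg hc _), Real.one_rpow, ← Real.rpow_mul hc,
      one_div_mul_cancel hq.ne', Real.rpow_one]
  rw [Finset.sum_const, nsmul_eq_mul, hs, ← mul_assoc, mul_comm (A.card : ℝ), mul_assoc,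
    Real.mul_rpow (Real.rpow_nonneg hD q) (by positivity), ← Real.rpow_mul hD,
    mul_one_div_cancel hq.ne', Real.rpow_one, mul_one_div]

theorem partDist_le_const {A : Finset F} {z w : F → M} {D : ℝ} (hD : 0 ≤ D)
    (h : ∀ x ∈ A, dist (z x) (w x) ≤ D) :
    partDist q A z w ≤ D * ((A.card : ℝ) / Fintype.card F) ^ (1 / q) := by
  have hq := exponent_pos (q := q)
  rw [← sum_const_rpow A hD]
  exact Real.rpow_le_rpow (sum_rpow_nonneg A z w) (Finset.sum_le_sum fun x hx =>
    Real.rpow_le_rpow (folnerScale_mul_dist_nonneg z w x)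
      (mul_le_mul_of_nonneg_left (h x hx) folnerScale_pos.le) hq.le) (one_div_nonneg.2 hq.le)

theorem const_le_partDist {A : Finset F} {z w : F → M} {D : ℝ} (hD : 0 ≤ D)
    (h : ∀ x ∈ A, D ≤ dist (z x) (w x)) :
    D * ((A.card : ℝ) / Fintype.card F) ^ (1 / q) ≤ partDist q A z w := by
  have hq := exponent_pos (q := q)
  rw [← sum_const_rpow A hD]
  exact Real.rpow_le_rpow (Finset.sum_nonneg fun x _ => by
      have := folnerScale_pos (q := q) (F := F); positivity) (Finset.sum_le_sum fun x hx =>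
    Real.rpow_le_rpow (mul_nonneg folnerScale_pos.le hD)
      (mul_le_mul_of_nonneg_left (h x hx) folnerScale_pos.le) hq.le) (one_div_nonneg.2 hq.le)

end PartDist

/-! ### The regular part of an ultraproduct of finite products -/

section Null

variable {U : Ultrafilter ℕ} {F : ℕ → Type}

/-- A sequence of subsets of the index sets is null if its cardinalities, multiplied by the weights
`c n`, tend to `0` along the ultrafilter. For `c n = 1 / #(F n)` this says that the densities tend
to `0`, and for `c n = 1` that almost all of the subsets are empty. -/
def IsNull (U : Ultrafilter ℕ) (c : ℕ → ℝ) (A : ∀ n, Finset (F n)) : Prop :=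
  Tendsto (fun n => c n * (A n).card) U (𝓝 0)

variable {c : ℕ → ℝ}

theorem IsNull.of_card_le_add (hc : ∀ n, 0 ≤ c n) {A B B' : ∀ n, Finset (F n)}
    (hB : IsNull U c B) (hB' : IsNull U c B')
    (h : ∀ᶠ n in U, (A n).card ≤ (B n).card + (B' n).card) : IsNull U c A := by
  have h0 := hB.add hB'
  rw [add_zero] at h0
  refine squeeze_zero' (Eventually.of_forall fun n => mul_nonneg (hc n) (Nat.cast_nonneg _)) ?_ h0
  filter_upwards [h] with n hn
  rw [← mul_add]
  exact mul_le_mul_of_nonneg_left (by exact_mod_cast hn) (hc n)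

theorem isNull_empty : IsNull U c (fun n => (∅ : Finset (F n))) := by
  simp [IsNull]

theorem IsNull.of_card_le (hc : ∀ n, 0 ≤ c n) {A B : ∀ n, Finset (F n)}
    (hB : IsNull U c B) (h : ∀ᶠ n in U, (A n).card ≤ (B n).card) : IsNull U c A :=
  hB.of_card_le_add hc isNull_empty (by simpa using h)

end Null

section Regular

variable {q : ℝ} {M : Type u} [MetricSpace M] {U : Ultrafilter ℕ} {F : ℕ → Type}
  [∀ n, Fintype (F n)] [∀ n, Nonempty (F n)] {y : ∀ n, F n → M}

variable {c : ℕ → ℝ}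

theorem IsNull.tendsto_density (hc : ∀ n, 1 / (Fintype.card (F n) : ℝ) ≤ c n)
    {A : ∀ n, Finset (F n)} (hA : IsNull U c A) :
    Tendsto (fun n => ((A n).card : ℝ) / Fintype.card (F n)) U (𝓝 0) := by
  refine squeeze_zero (fun n => by positivity) (fun n => ?_) hA
  rw [div_eq_mul_one_div, mul_comm]
  exact mul_le_mul_of_nonneg_right (hc n) (Nat.cast_nonneg _)

variable [hq1 : Fact (1 ≤ q)]

theorem IsNull.tendsto_const_mul (hc : ∀ n, 1 / (Fintype.card (F n) : ℝ) ≤ c n)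
    {A : ∀ n, Finset (F n)} (hA : IsNull U c A) (D : ℝ) :
    Tendsto (fun n => D * (((A n).card : ℝ) / Fintype.card (F n)) ^ (1 / q)) U (𝓝 0) := by
  have hq := exponent_pos (q := q)
  have h := ((hA.tendsto_density hc).rpow_const (p := 1 / q)
    (Or.inr (one_div_nonneg.2 hq.le))).const_mul D
  rwa [Real.zero_rpow (one_div_pos.2 hq).ne', mul_zero] at h

/-- The bounded sequences that represent points of `FolnerSpace q M U F y`. -/
abbrev PreFolner (q : ℝ) [Fact (1 ≤ q)] (M : Type u) [MetricSpace M] (U : Ultrafilter ℕ)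
    (F : ℕ → Type) [∀ m, Fintype (F m)] [∀ m, Nonempty (F m)] (y : ∀ m, F m → M) : Type u :=
  PreUltraproduct U (fun m => FinProd q M (F m) (y m)) (fun _ => LqProd.base)

namespace PreFolner

theorem tendsto_partDist (z w : PreFolner q M U F y) :
    Tendsto (fun n => partDist q Finset.univ (z.1 n).1 (w.1 n).1) U (𝓝 (dist z w)) := by
  simpa only [dist_eq_partDist] using PreUltraproduct.tendsto_dist z w

theorem exists_dist_base_le {z : ∀ n, F n → M}
    (hz : ∃ D : ℝ, ∀ n, partDist q Finset.univ (z n) (y n) ≤ D) :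
    ∃ D : ℝ, ∀ n, dist (FinProd.ofFun (z n) : FinProd q M (F n) (y n)) LqProd.base ≤ D := by
  simpa only [FinProd.dist_ofFun_base] using hz

/-- A bounded sequence, given by its coordinates. -/
def ofFun (z : ∀ n, F n → M) (hz : ∃ D : ℝ, ∀ n, partDist q Finset.univ (z n) (y n) ≤ D) :
    PreFolner q M U F y :=
  ⟨fun n => FinProd.ofFun (z n), exists_dist_base_le hz⟩

theorem exists_bound (z : PreFolner q M U F y) :
    ∃ D : ℝ, ∀ n, partDist q Finset.univ (z.1 n).1 (y n) ≤ D := by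
  have h := z.2
  simp only [dist_eq_partDist] at h
  exact h

/-- The sequence of the base points. -/
def base : PreFolner q M U F y :=
  ofFun y ⟨0, fun _ => (partDist_eq_zero fun _ _ => rfl).le⟩

/-- A bounded sequence is regular if its distance to the base points does not concentrate on null
sequences of subsets (a form of equi-integrability). -/
def IsRegular (c : ℕ → ℝ) (z : PreFolner q M U F y) : Prop :=
  ∀ A : ∀ n, Finset (F n), IsNull U c A →
    Tendsto (fun n => partDist q (A n) (z.1 n).1 (y n)) U (𝓝 0)

theorem isRegular_base : IsRegular c (base : PreFolner q M U F y) := fun A _ => by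
  refine tendsto_const_nhds.congr fun n => ?_
  exact (partDist_eq_zero fun _ _ => rfl).symm

theorem IsRegular.tendsto {z w : PreFolner q M U F y} (hz : IsRegular c z) (hw : IsRegular c w)
    {A : ∀ n, Finset (F n)} (hA : IsNull U c A) :
    Tendsto (fun n => partDist q (A n) (z.1 n).1 (w.1 n).1) U (𝓝 0) := by
  have h := (hz A hA).add (hw A hA)
  rw [add_zero] at h
  refine squeeze_zero (fun n => partDist_nonneg _ _ _) (fun n => ?_) h
  rw [partDist_comm (A n) (w.1 n).1]
  exact partDist_triangle _ _ _ _

/-- Regular sequences that agree outside of a null sequence of subsets have distance `0`. -/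
theorem IsRegular.dist_eq_zero {z w : PreFolner q M U F y} (hz : IsRegular c z)
    (hw : IsRegular c w) {A : ∀ n, Finset (F n)} (hA : IsNull U c A)
    (h : ∀ᶠ n in U, ∀ x ∉ A n, (z.1 n).1 x = (w.1 n).1 x) : dist z w = 0 := by
  classical
  refine tendsto_nhds_unique (tendsto_partDist z w) (squeeze_zero'
    (Eventually.of_forall fun n => partDist_nonneg _ _ _) ?_ (hz.tendsto hw hA))
  filter_upwards [h] with n hn
  refine (partDist_univ_le_add (A n) _ _).trans_eq ?_
  rw [partDist_eq_zero fun x hx => hn x (Finset.mem_compl.1 hx), zero_add]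

/-- The set of regular sequences is closed. -/
theorem isRegular_of_forall_exists {z : PreFolner q M U F y}
    (h : ∀ ε > 0, ∃ w : PreFolner q M U F y, IsRegular c w ∧ dist z w < ε) : IsRegular c z := by
  intro A hA
  refine tendsto_order.2 ⟨fun a ha => Eventually.of_forall fun n =>
    ha.trans_le (partDist_nonneg _ _ _), fun ε hε => ?_⟩
  obtain ⟨w, hw, hzw⟩ := h (ε / 2) (half_pos hε)
  filter_upwards [(tendsto_order.1 (hw A hA)).2 _ (half_pos hε),
    (tendsto_order.1 (tendsto_partDist z w)).2 _ hzw] with n h1 h2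
  have h3 := partDist_triangle (q := q) (A n) (z.1 n).1 (w.1 n).1 (y n)
  have h4 := partDist_mono (q := q) (Finset.subset_univ (A n)) (z.1 n).1 (w.1 n).1
  linarith

theorem IsRegular.congr {z w : PreFolner q M U F y} (hw : IsRegular c w) (h : dist z w = 0) :
    IsRegular c z :=
  isRegular_of_forall_exists fun _ hε => ⟨w, hw, h.trans_lt hε⟩

end PreFolner

open PreFolner

/-- The regular part of `FolnerSpace q M U F y`: the set of the points that are represented by
regular sequences. -/
def regularPart (q : ℝ) [Fact (1 ≤ q)] {M : Type u} [MetricSpace M] (U : Ultrafilter ℕ)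
    {F : ℕ → Type} [∀ m, Fintype (F m)] [∀ m, Nonempty (F m)] (y : ∀ m, F m → M) (c : ℕ → ℝ) :
    Set (FolnerSpace q M U F y) :=
  SeparationQuotient.mk '' {z : PreFolner q M U F y | IsRegular c z}

theorem mk_mem_regularPart {z : PreFolner q M U F y} :
    SeparationQuotient.mk z ∈ regularPart q U y c ↔ IsRegular c z := by
  refine ⟨?_, fun h => ⟨z, h, rfl⟩⟩
  rintro ⟨w, hw, hwz⟩
  refine IsRegular.congr hw ?_
  rw [← SeparationQuotient.dist_mk, hwz, dist_self]

theorem isClosed_regularPart : IsClosed (regularPart q U y c) := by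
  refine isClosed_of_closure_subset fun ζ hζ => ?_
  obtain ⟨z, rfl⟩ := SeparationQuotient.surjective_mk ζ
  refine mk_mem_regularPart.2 (isRegular_of_forall_exists fun ε hε => ?_)
  obtain ⟨_, ⟨w, hw, rfl⟩, h⟩ := Metric.mem_closure_iff.1 hζ ε hε
  exact ⟨w, hw, by rwa [SeparationQuotient.dist_mk] at h⟩

theorem regularPart_nonempty : (regularPart q U y c).Nonempty :=
  ⟨_, mk_mem_regularPart.2 isRegular_base⟩

/-- For the weights `1`, null sequences are almost always empty, and every point is regular. -/
theorem regularPart_one : regularPart q U y (fun _ => 1) = Set.univ := by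
  refine Set.eq_univ_of_forall fun ζ => ?_
  obtain ⟨z, rfl⟩ := SeparationQuotient.surjective_mk ζ
  refine mk_mem_regularPart.2 fun A hA => tendsto_const_nhds.congr' ?_
  filter_upwards [(tendsto_order.1 hA).2 1 one_pos] with n hn
  rw [one_mul, Nat.cast_lt_one, Finset.card_eq_zero] at hn
  rw [hn]
  exact (partDist_eq_zero fun x hx => absurd hx (Finset.notMem_empty x)).symm

/-- A point `u` that lies metrically between two regular points `z` and `w` is regular: on a null
sequence `A`, where `z` and `w` are close to each other, `u` could only deviate from both by a
detour. -/
theorem isRegular_of_dist_add_dist_le {z w u : PreFolner q M U F y} (hz : IsRegular c z)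
    (hw : IsRegular c w) (h : dist z u + dist u w ≤ dist z w) : IsRegular c u := by
  classical
  have hq := exponent_pos (q := q)
  intro A hA
  have heq : dist z w - dist u w = dist z u := by linarith [dist_triangle z u w]
  have hlow : Tendsto (fun n => partDist q Finset.univ (z.1 n).1 (w.1 n).1 -
      partDist q (A n) (z.1 n).1 (w.1 n).1 - partDist q Finset.univ (u.1 n).1 (w.1 n).1) U
      (𝓝 (dist z u)) := by
    have := ((tendsto_partDist z w).sub (hz.tendsto hw hA)).sub (tendsto_partDist u w)
    rwa [sub_zero, heq] at this
  -- The distance of `z` and `u` is attained off `A`.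
  have hcompl : Tendsto (fun n => partDist q (A n)ᶜ (z.1 n).1 (u.1 n).1) U (𝓝 (dist z u)) := by
    refine tendsto_of_tendsto_of_tendsto_of_le_of_le hlow (tendsto_partDist z u) (fun n => ?_)
      fun n => partDist_mono (Finset.subset_univ _) _ _
    have h1 := partDist_univ_le_add (q := q) (A n) (z.1 n).1 (w.1 n).1
    have h2 := partDist_triangle (q := q) (A n)ᶜ (z.1 n).1 (u.1 n).1 (w.1 n).1
    have h3 := partDist_mono (q := q) (Finset.subset_univ (A n)ᶜ) (u.1 n).1 (w.1 n).1
    dsimp only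
    linarith
  have hzero : Tendsto (fun n => partDist q (A n) (z.1 n).1 (u.1 n).1) U (𝓝 0) := by
    have h1 := (((tendsto_partDist z u).rpow_const (p := q) (Or.inr hq.le)).sub
      (hcompl.rpow_const (p := q) (Or.inr hq.le))).rpow_const (p := 1 / q)
        (Or.inr (one_div_nonneg.2 hq.le))
    rw [sub_self, Real.zero_rpow (one_div_pos.2 hq).ne'] at h1
    refine h1.congr fun n => ?_
    rw [partDist_univ_rpow (A n), add_sub_cancel_left, ← Real.rpow_mul (partDist_nonneg _ _ _),
      mul_one_div_cancel hq.ne', Real.rpow_one]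
  have h1 := hzero.add (hz A hA)
  rw [add_zero] at h1
  refine squeeze_zero (fun n => partDist_nonneg _ _ _) (fun n => ?_) h1
  rw [partDist_comm (A n) (z.1 n).1 (u.1 n).1]
  exact partDist_triangle _ _ _ _

theorem isGeodesicallyConvex_regularPart : IsGeodesicallyConvex (regularPart q U y c) := by
  rintro _ ⟨z, hz, rfl⟩ _ ⟨w, hw, rfl⟩ γ ⟨hγ, h0, h1⟩ t
  obtain ⟨u, hu⟩ := SeparationQuotient.surjective_mk (γ t)
  rw [← hu]
  refine mk_mem_regularPart.2 (isRegular_of_dist_add_dist_le hz hw (le_of_eq ?_))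
  have e1 := hγ.dist_eq ⟨0, le_refl 0, dist_nonneg⟩ t
  have e2 := hγ.dist_eq t ⟨_, dist_nonneg, le_refl _⟩
  rw [h0, ← hu, SeparationQuotient.dist_mk, Subtype.dist_eq, Real.dist_eq] at e1
  rw [h1, ← hu, SeparationQuotient.dist_mk, Subtype.dist_eq, Real.dist_eq] at e2
  rw [e1, e2, abs_of_nonpos (sub_nonpos.2 t.2.1), abs_of_nonpos (sub_nonpos.2 t.2.2),
    neg_sub, neg_sub, sub_zero]
  linarith [SeparationQuotient.dist_mk z w]

end Regular

/-! ### Almost actions and the limit action on the regular part -/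

/-- `1`-Lipschitz maps that compose like the elements of a group, in the opposite order, form a
right action by isometries. -/
theorem exists_isometric_action {Γ : Type v} [Group Γ] {X : Type u} [MetricSpace X] (f : Γ → X → X)
    (hf : ∀ g x x', dist (f g x) (f g x') ≤ dist x x') (h1 : ∀ x, f 1 x = x)
    (hmul : ∀ g h x, f (g * h) x = f h (f g x)) :
    ∃ α : Γᵐᵒᵖ →* (X ≃ᵢ X), ∀ g x, α (MulOpposite.op g) x = f g x := by
  have hinv : ∀ g x, f g (f g⁻¹ x) = x := fun g x => by rw [← hmul, inv_mul_cancel, h1]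
  have hinv' : ∀ g x, f g⁻¹ (f g x) = x := fun g x => by rw [← hmul, mul_inv_cancel, h1]
  refine ⟨{ toFun := fun g =>
              { toFun := f g.unop
                invFun := f g.unop⁻¹
                left_inv := hinv' _
                right_inv := hinv _
                isometry_toFun := Isometry.of_dist_eq fun x x' => le_antisymm (hf _ x x') ?_ }
            map_one' := IsometryEquiv.ext h1
            map_mul' := fun g h => IsometryEquiv.ext (hmul h.unop g.unop) }, fun g x => rfl⟩
  have := hf g.unop⁻¹ (f g.unop x) (f g.unop x')
  rwa [hinv', hinv'] at this

/-- A right action of the group `Γ` in the limit, on sequences of functions `F n → M`: the element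
`g` takes `z` to the function `x ↦ iso n g x (z (trans n g x))`, where `trans n g` is a partial
injection of `F n` and the `iso n g x` are isometries of `M`. The domain `dom n g` of the partial
injection exhausts `F n` up to a null sequence, and the group law holds almost always. -/
structure AlmostAction (Γ : Type v) [Group Γ] {M : Type u} [MetricSpace M] (U : Ultrafilter ℕ)
    {F : ℕ → Type} [∀ n, Fintype (F n)] [∀ n, DecidableEq (F n)] (y : ∀ n, F n → M)
    (c : ℕ → ℝ) where
  /-- the domain of the partial injection -/
  dom : ∀ n, Γ → Finset (F n)
  /-- the partial injection, with junk values outside of its domain -/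
  trans : ∀ n, Γ → F n → F n
  /-- the isometries that twist the translated functions -/
  iso : ∀ n, Γ → F n → M ≃ᵢ M
  /-- `trans n g` is injective on its domain -/
  injOn : ∀ n g, Set.InjOn (trans n g) (dom n g)
  /-- the domains are almost everything -/
  isNull_compl : ∀ g, IsNull U c fun n => (dom n g)ᶜ
  /-- the base point is moved by a uniformly bounded distance -/
  exists_bound : ∀ g, ∃ D : ℝ, ∀ n, ∀ x ∈ dom n g,
    dist (iso n g x (y n (trans n g x))) (y n x) ≤ D
  /-- the unit acts trivially -/
  one : ∀ᶠ n in U, ∀ x ∈ dom n 1, trans n 1 x = x ∧ iso n 1 x = IsometryEquiv.refl M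
  /-- the group law of a right action -/
  mul : ∀ g h, ∀ᶠ n in U, ∀ x ∈ dom n h, trans n h x ∈ dom n g → x ∈ dom n (g * h) →
    trans n (g * h) x = trans n g (trans n h x) ∧
      ∀ p, iso n (g * h) x p = iso n h x (iso n g (trans n h x) p)

namespace AlmostAction

variable {Γ : Type v} [Group Γ] {q : ℝ} [hq1 : Fact (1 ≤ q)] {M : Type u} [MetricSpace M]
  {U : Ultrafilter ℕ} {F : ℕ → Type} [∀ n, Fintype (F n)] [∀ n, DecidableEq (F n)]
  {y : ∀ n, F n → M} {c : ℕ → ℝ} (a : AlmostAction Γ U y c)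

/-- The transformation of functions `F n → M` given by `g`, with the base point as default value
outside of the domain. -/
def actFun (n : ℕ) (g : Γ) (z : F n → M) (x : F n) : M :=
  if x ∈ a.dom n g then a.iso n g x (z (a.trans n g x)) else y n x

theorem actFun_of_mem {n : ℕ} {g : Γ} {x : F n} (hx : x ∈ a.dom n g) (z : F n → M) :
    a.actFun n g z x = a.iso n g x (z (a.trans n g x)) := if_pos hx

theorem actFun_of_notMem {n : ℕ} {g : Γ} {x : F n} (hx : x ∉ a.dom n g) (z : F n → M) :
    a.actFun n g z x = y n x := if_neg hx

theorem exists_dist_actFun_base_le (g : Γ) :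
    ∃ D : ℝ, 0 ≤ D ∧ ∀ n x, dist (a.actFun n g (y n) x) (y n x) ≤ D := by
  obtain ⟨D, hD⟩ := a.exists_bound g
  refine ⟨max D 0, le_max_right _ _, fun n x => ?_⟩
  by_cases hx : x ∈ a.dom n g
  · rw [a.actFun_of_mem hx]
    exact (hD n x hx).trans (le_max_left _ _)
  · rw [a.actFun_of_notMem hx, dist_self]
    exact le_max_right _ _

variable [∀ n, Nonempty (F n)]

theorem partDist_actFun_le (n : ℕ) (g : Γ) (A : Finset (F n)) (z w : F n → M) :
    partDist q A (a.actFun n g z) (a.actFun n g w) ≤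
      partDist q ((A ∩ a.dom n g).image (a.trans n g)) z w := by
  have h : partDist q A (a.actFun n g z) (a.actFun n g w) =
      partDist q (A ∩ a.dom n g) (a.actFun n g z) (a.actFun n g w) := by
    unfold partDist
    rw [Finset.sum_subset Finset.inter_subset_left]
    intro x hxA hx
    have hxd : x ∉ a.dom n g := fun h => hx (Finset.mem_inter.2 ⟨hxA, h⟩)
    rw [a.actFun_of_notMem hxd, a.actFun_of_notMem hxd, dist_self, mul_zero,
      Real.zero_rpow (exponent_pos (q := q)).ne']
  rw [h, partDist_image ((a.injOn n g).mono (by simp))]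
  intro x hx
  have hxd := (Finset.mem_inter.1 hx).2
  rw [a.actFun_of_mem hxd, a.actFun_of_mem hxd, IsometryEquiv.dist_eq]

theorem partDist_actFun_univ_le (n : ℕ) (g : Γ) (z w : F n → M) :
    partDist q Finset.univ (a.actFun n g z) (a.actFun n g w) ≤ partDist q Finset.univ z w :=
  (a.partDist_actFun_le n g _ z w).trans (partDist_mono (Finset.subset_univ _) _ _)

theorem exists_partDist_actFun_le (g : Γ) (z : PreFolner q M U F y) :
    ∃ D : ℝ, ∀ n, partDist q Finset.univ (a.actFun n g (z.1 n).1) (y n) ≤ D := by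
  obtain ⟨D, hD⟩ := z.exists_bound
  obtain ⟨E, hE0, hE⟩ := a.exists_dist_actFun_base_le g
  refine ⟨D + E, fun n => (partDist_triangle _ _ (a.actFun n g (y n)) _).trans (add_le_add
    ((a.partDist_actFun_univ_le n g _ _).trans (hD n))
    ((partDist_le_const hE0 fun x _ => hE n x).trans_eq ?_))⟩
  have hc : (Fintype.card (F n) : ℝ) ≠ 0 := Nat.cast_ne_zero.2 Fintype.card_ne_zero
  rw [Finset.card_univ, div_self hc, Real.one_rpow, mul_one]

/-- The transformation of bounded sequences given by `g`. -/
def preAct (g : Γ) (z : PreFolner q M U F y) : PreFolner q M U F y :=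
  PreFolner.ofFun (fun n => a.actFun n g (z.1 n).1) (a.exists_partDist_actFun_le g z)

theorem preAct_apply (g : Γ) (z : PreFolner q M U F y) (n : ℕ) :
    ((a.preAct g z).1 n).1 = a.actFun n g (z.1 n).1 := rfl

theorem dist_preAct_le (g : Γ) (z w : PreFolner q M U F y) :
    dist (a.preAct g z) (a.preAct g w) ≤ dist z w :=
  le_of_tendsto_of_tendsto (PreFolner.tendsto_partDist _ _) (PreFolner.tendsto_partDist z w)
    (Eventually.of_forall fun n => a.partDist_actFun_univ_le n g _ _)

/-- The transformation of the ultraproduct given by `g`. -/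
def act (g : Γ) : FolnerSpace q M U F y → FolnerSpace q M U F y :=
  SeparationQuotient.lift (fun z => SeparationQuotient.mk (a.preAct g z)) fun z w h => by
    rw [SeparationQuotient.mk_eq_mk, Metric.inseparable_iff]
    exact le_antisymm ((a.dist_preAct_le g z w).trans_eq (Metric.inseparable_iff.1 h)) dist_nonneg

theorem act_mk (g : Γ) (z : PreFolner q M U F y) :
    a.act g (SeparationQuotient.mk z) = SeparationQuotient.mk (a.preAct g z) := rfl

theorem dist_act_le (g : Γ) (ζ ξ : FolnerSpace q M U F y) :
    dist (a.act g ζ) (a.act g ξ) ≤ dist ζ ξ := by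
  obtain ⟨z, rfl⟩ := SeparationQuotient.surjective_mk ζ
  obtain ⟨w, rfl⟩ := SeparationQuotient.surjective_mk ξ
  rw [act_mk, act_mk, SeparationQuotient.dist_mk, SeparationQuotient.dist_mk]
  exact a.dist_preAct_le g z w

theorem isRegular_preAct (hc : ∀ n, 1 / (Fintype.card (F n) : ℝ) ≤ c n)
    (g : Γ) {z : PreFolner q M U F y} (hz : z.IsRegular c) :
    (a.preAct g z).IsRegular c := by
  intro A hA
  have hc0 : ∀ n, 0 ≤ c n := fun n => le_trans (by positivity) (hc n)
  obtain ⟨D, hD0, hD⟩ := a.exists_dist_actFun_base_le g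
  have hA' : IsNull U c fun n => (A n ∩ a.dom n g).image (a.trans n g) :=
    hA.of_card_le hc0 (Eventually.of_forall fun n =>
      Finset.card_image_le.trans (Finset.card_le_card Finset.inter_subset_left))
  have h := (hz _ hA').add (hA.tendsto_const_mul (q := q) hc D)
  rw [add_zero] at h
  refine squeeze_zero (fun n => partDist_nonneg _ _ _) (fun n => ?_) h
  rw [preAct_apply]
  exact (partDist_triangle _ _ (a.actFun n g (y n)) _).trans (add_le_add
    (a.partDist_actFun_le n g _ _ _) (partDist_le_const hD0 fun x _ => hD n x))

theorem act_mem (hc : ∀ n, 1 / (Fintype.card (F n) : ℝ) ≤ c n)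
    (g : Γ) {ζ : FolnerSpace q M U F y} (hζ : ζ ∈ regularPart q U y c) :
    a.act g ζ ∈ regularPart q U y c := by
  obtain ⟨z, hz, rfl⟩ := hζ
  exact mk_mem_regularPart.2 (a.isRegular_preAct hc g hz)

theorem act_one (hc : ∀ n, 1 / (Fintype.card (F n) : ℝ) ≤ c n)
    {ζ : FolnerSpace q M U F y} (hζ : ζ ∈ regularPart q U y c) : a.act 1 ζ = ζ := by
  obtain ⟨z, hz, rfl⟩ := hζ
  rw [act_mk, SeparationQuotient.mk_eq_mk, Metric.inseparable_iff]
  refine (a.isRegular_preAct hc 1 hz).dist_eq_zero hz (a.isNull_compl 1) ?_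
  filter_upwards [a.one] with n hn x hx
  rw [Finset.notMem_compl] at hx
  rw [preAct_apply, a.actFun_of_mem hx, (hn x hx).1, (hn x hx).2]
  rfl

theorem act_mul (hc : ∀ n, 1 / (Fintype.card (F n) : ℝ) ≤ c n)
    (g h : Γ) {ζ : FolnerSpace q M U F y} (hζ : ζ ∈ regularPart q U y c) :
    a.act (g * h) ζ = a.act h (a.act g ζ) := by
  have hc0 : ∀ n, 0 ≤ c n := fun n => le_trans (by positivity) (hc n)
  obtain ⟨z, hz, rfl⟩ := hζ
  rw [act_mk, act_mk, act_mk, SeparationQuotient.mk_eq_mk, Metric.inseparable_iff]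
  -- Points that leave the domain of `g` are the preimages, under the injective map `trans n h`, of
  -- a null sequence.
  have hB : IsNull U c fun n => (a.dom n h).filter fun x => a.trans n h x ∉ a.dom n g := by
    refine (a.isNull_compl g).of_card_le hc0 (Eventually.of_forall fun n => ?_)
    refine Finset.card_le_card_of_injOn (a.trans n h) (fun x hx => ?_)
      ((a.injOn n h).mono fun x hx => ?_)
    · simpa using (Finset.mem_filter.1 hx).2
    · exact (Finset.mem_filter.1 hx).1
  have hA : IsNull U c fun n => (a.dom n h)ᶜ ∪ (a.dom n (g * h))ᶜ :=
    (a.isNull_compl h).of_card_le_add hc0 (a.isNull_compl (g * h))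
      (Eventually.of_forall fun n => Finset.card_union_le _ _)
  refine (a.isRegular_preAct hc (g * h) hz).dist_eq_zero
    (a.isRegular_preAct hc h (a.isRegular_preAct hc g hz))
    (hA.of_card_le_add hc0 hB (Eventually.of_forall fun n => Finset.card_union_le _ _)) ?_
  filter_upwards [a.mul g h] with n hn x hx
  simp only [Finset.mem_union, Finset.mem_compl, Finset.mem_filter, not_or, not_not, not_and]
    at hx
  obtain ⟨⟨hxh, hxgh⟩, hxg⟩ := hx
  rw [preAct_apply, preAct_apply, preAct_apply, a.actFun_of_mem hxgh, a.actFun_of_mem hxh,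
    a.actFun_of_mem (hxg hxh), (hn x hxh (hxg hxh) hxgh).1, (hn x hxh (hxg hxh) hxgh).2]

/-- An almost action becomes a right action by isometries on the regular part of the
ultraproduct. -/
theorem exists_action_regularPart (hc : ∀ n, 1 / (Fintype.card (F n) : ℝ) ≤ c n) :
    ∃ α : Γᵐᵒᵖ →* (regularPart q U y c ≃ᵢ regularPart q U y c),
      ∀ g ζ, (α (MulOpposite.op g) ζ : FolnerSpace q M U F y) = a.act g ζ := by
  obtain ⟨α, hα⟩ := exists_isometric_action
    (fun (g : Γ) (ζ : regularPart q U y c) =>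
      (⟨a.act g ζ.1, a.act_mem hc g ζ.2⟩ : regularPart q U y c))
    (fun g ζ ξ => a.dist_act_le g ζ.1 ξ.1) (fun ζ => Subtype.ext (a.act_one hc ζ.2))
    (fun g h ζ => Subtype.ext (a.act_mul hc g h ζ.2))
  exact ⟨α, fun g ζ => by rw [hα]⟩

/-- Bounds that hold for almost all coordinates of the orbit of the base point hold for the limit,
because the `ℓ_q`-product is normalized. -/
theorem dist_act_base_mem_Icc (hc : ∀ n, 1 / (Fintype.card (F n) : ℝ) ≤ c n)
    {g h : Γ} {r R : ℝ} (hr : 0 ≤ r) (hR : 0 ≤ R)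
    (H : ∀ᶠ n in U, ∀ x ∈ a.dom n g, x ∈ a.dom n h →
      dist (a.iso n g x (y n (a.trans n g x))) (a.iso n h x (y n (a.trans n h x))) ∈
        Set.Icc r R) :
    dist (a.act g (SeparationQuotient.mk (PreFolner.base : PreFolner q M U F y)))
      (a.act h (SeparationQuotient.mk PreFolner.base)) ∈ Set.Icc r R := by
  have hc0 : ∀ n, 0 ≤ c n := fun n => le_trans (by positivity) (hc n)
  have hq := exponent_pos (q := q)
  have hb := PreFolner.isRegular_base (q := q) (U := U) (y := y) (c := c)
  have hA : IsNull U c fun n => (a.dom n g)ᶜ ∪ (a.dom n h)ᶜ :=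
    (a.isNull_compl g).of_card_le_add hc0 (a.isNull_compl h)
      (Eventually.of_forall fun n => Finset.card_union_le _ _)
  have hlim := PreFolner.tendsto_partDist (a.preAct g (PreFolner.base : PreFolner q M U F y))
    (a.preAct h PreFolner.base)
  have hsmall := (a.isRegular_preAct hc g hb).tendsto (a.isRegular_preAct hc h hb) hA
  -- The complements of a null sequence have density tending to `1`.
  have hdens : Tendsto (fun n => (((((a.dom n g)ᶜ ∪ (a.dom n h)ᶜ)ᶜ : Finset (F n)).card : ℝ) /
      Fintype.card (F n)) ^ (1 / q)) U (𝓝 1) := by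
    have h1 := ((hA.tendsto_density hc).const_sub 1).rpow_const (p := 1 / q)
      (Or.inr (one_div_nonneg.2 hq.le))
    rw [sub_zero, Real.one_rpow] at h1
    refine h1.congr fun n => ?_
    have hF : (Fintype.card (F n) : ℝ) ≠ 0 := Nat.cast_ne_zero.2 Fintype.card_ne_zero
    rw [Finset.card_compl, Nat.cast_sub (Finset.card_le_univ _), sub_div, div_self hF]
  have hcoord : ∀ᶠ n in U, ∀ x ∈ ((a.dom n g)ᶜ ∪ (a.dom n h)ᶜ)ᶜ,
      dist (a.actFun n g (y n) x) (a.actFun n h (y n) x) ∈ Set.Icc r R := by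
    filter_upwards [H] with n hn x hx
    simp only [Finset.mem_union, Finset.mem_compl, not_or, not_not] at hx
    rw [a.actFun_of_mem hx.1, a.actFun_of_mem hx.2]
    exact hn x hx.1 hx.2
  rw [act_mk, act_mk, SeparationQuotient.dist_mk]
  constructor
  · have h1 := hdens.const_mul r
    rw [mul_one] at h1
    refine le_of_tendsto_of_tendsto h1 hlim ?_
    filter_upwards [hcoord] with n hn
    exact (const_le_partDist hr fun x hx => (hn x hx).1).trans
      (partDist_mono (Finset.subset_univ _) _ _)
  · have h1 := (hdens.const_mul R).add hsmall
    rw [mul_one, add_zero] at h1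
    refine le_of_tendsto_of_tendsto hlim h1 ?_
    filter_upwards [hcoord] with n hn
    exact (partDist_univ_le_add ((a.dom n g)ᶜ ∪ (a.dom n h)ᶜ) _ _).trans (add_le_add
      (partDist_le_const hR fun x hx => (hn x hx).2) le_rfl)

end AlmostAction

/-! ### Completeness of ultraproducts -/

/-- Metric ultraproducts over a non-principal ultrafilter on `ℕ` are complete, whether or not the
factors are: a limit is obtained by passing diagonally through the terms of a Cauchy sequence. -/
theorem PreUltraproduct.completeSpace {U : Ultrafilter ℕ} (hU : (U : Filter ℕ) ≤ atTop)
    {N : ℕ → Type u} [∀ m, MetricSpace (N m)] {y : ∀ m, N m} :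
    CompleteSpace (PreUltraproduct U N y) := by
  classical
  let B : ℕ → ℝ := fun n => 1 / ((n : ℝ) + 1)
  have hB : ∀ n, 0 < B n := fun n => Nat.one_div_pos_of_nat
  refine Metric.complete_of_convergent_controlled_sequences B hB fun u hu => ?_
  let P : ℕ → ℕ → Prop := fun K m => ∀ i ≤ K, dist ((u K).1 m) ((u i).1 m) < B i
  have hP : ∀ K, ∀ᶠ m in (U : Filter ℕ), P K m := fun K =>
    (eventually_all_finite (Set.finite_le_nat K)).2 fun i hi =>
      (tendsto_order.1 (tendsto_dist (u K) (u i))).2 _ (hu i K i hi le_rfl)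
  obtain ⟨K, hK, hKP⟩ := exists_tendsto_atTop_of_eventually hU hP
  let x : ∀ m, N m := fun m => if P (K m) m then (u (K m)).1 m else y m
  have hx : ∃ D : ℝ, ∀ m, dist (x m) (y m) ≤ D := by
    obtain ⟨D, hD⟩ := (u 0).2
    have hD0 : 0 ≤ D := dist_nonneg.trans (hD 0)
    refine ⟨B 0 + D, fun m => ?_⟩
    by_cases h : P (K m) m
    · have hxm : x m = (u (K m)).1 m := if_pos h
      rw [hxm]
      exact (dist_triangle _ _ _).trans (add_le_add (h 0 (Nat.zero_le _)).le (hD m))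
    · have hxm : x m = y m := if_neg h
      rw [hxm, dist_self]
      exact add_nonneg (hB 0).le hD0
  let X : PreUltraproduct U N y := ⟨x, hx⟩
  have hle : ∀ i, dist (u i) X ≤ B i := fun i => by
    rw [dist_comm]
    refine le_of_tendsto (tendsto_dist X (u i)) ?_
    filter_upwards [hKP, hK.eventually_ge_atTop i] with m h1 h2
    have hxm : X.1 m = (u (K m)).1 m := if_pos h1
    rw [hxm]
    exact (h1 i h2).le
  refine ⟨X, tendsto_iff_dist_tendsto_zero.2 ?_⟩
  exact squeeze_zero (fun _ => dist_nonneg) hle tendsto_one_div_add_atTop_nhds_zero_nat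

/-! ### The Banach space structure of the regular part -/

theorem partDist_add_right_self {q : ℝ} {E : Type u} [NormedAddCommGroup E] {F : Type} [Fintype F]
    [Nonempty F] (A : Finset F) (v w : F → E) : partDist q A (v + w) w = partDist q A v 0 :=
  partDist_congr fun x _ => by simp [dist_eq_norm]

section Banach

variable {q : ℝ} [hq1 : Fact (1 ≤ q)] {𝕜 : Type} [RCLike 𝕜] {E : Type u} [NormedAddCommGroup E]
  [NormedSpace 𝕜 E]

section Fin

variable {F : Type} [Fintype F] [Nonempty F]

theorem partDist_add_zero_le (A : Finset F) (v w : F → E) :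
    partDist q A (v + w) 0 ≤ partDist q A v 0 + partDist q A w 0 := by
  refine (partDist_triangle A _ w _).trans (add_le_add (le_of_eq ?_) le_rfl)
  exact partDist_congr fun x _ => by simp [dist_eq_norm]

theorem partDist_smul_zero (A : Finset F) (b : 𝕜) (v : F → E) :
    partDist q A (b • v) 0 = ‖b‖ * partDist q A v 0 := by
  have hq := exponent_pos (q := q)
  have hs : ∀ x, ((folnerScale q F : ℝ) * dist ((b • v) x) ((0 : F → E) x)) ^ q =
      ‖b‖ ^ q * ((folnerScale q F : ℝ) * dist (v x) ((0 : F → E) x)) ^ q := fun x => by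
    rw [← Real.mul_rpow (norm_nonneg b) (folnerScale_mul_dist_nonneg v 0 x)]
    simp only [Pi.smul_apply, Pi.zero_apply, dist_zero_right, norm_smul]
    ring_nf
  unfold partDist
  simp only [hs]
  rw [← Finset.mul_sum, Real.mul_rpow (Real.rpow_nonneg (norm_nonneg b) q)
    (sum_rpow_nonneg A v 0), ← Real.rpow_mul (norm_nonneg b), mul_one_div_cancel hq.ne',
    Real.rpow_one]

theorem partDist_zero_zero (A : Finset F) : partDist q A (0 : F → E) 0 = 0 :=
  partDist_eq_zero fun _ _ => rfl

end Fin

variable {U : Ultrafilter ℕ} {F : ℕ → Type} [∀ n, Fintype (F n)] [∀ n, Nonempty (F n)]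
  {y : ∀ n, F n → E} {c : ℕ → ℝ}

/-- The linear space of the differences between regular sequences and the base points. -/
def regularSubmodule (q : ℝ) [Fact (1 ≤ q)] (𝕜 : Type) [RCLike 𝕜] (E : Type u)
    [NormedAddCommGroup E] [NormedSpace 𝕜 E] (U : Ultrafilter ℕ) (F : ℕ → Type)
    [∀ n, Fintype (F n)] [∀ n, Nonempty (F n)] (c : ℕ → ℝ) : Submodule 𝕜 (∀ n, F n → E) where
  carrier := {v | (∃ D : ℝ, ∀ n, partDist q Finset.univ (v n) 0 ≤ D) ∧
    ∀ A : ∀ n, Finset (F n), IsNull U c A → Tendsto (fun n => partDist q (A n) (v n) 0) U (𝓝 0)}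
  zero_mem' := ⟨⟨0, fun _ => (partDist_zero_zero _).le⟩, fun _ _ =>
    tendsto_const_nhds.congr fun _ => (partDist_zero_zero _).symm⟩
  add_mem' := by
    rintro v w ⟨⟨D, hD⟩, hv⟩ ⟨⟨D', hD'⟩, hw⟩
    refine ⟨⟨D + D', fun n => (partDist_add_zero_le _ _ _).trans (add_le_add (hD n) (hD' n))⟩,
      fun A hA => ?_⟩
    have h := (hv A hA).add (hw A hA)
    rw [add_zero] at h
    exact squeeze_zero (fun n => partDist_nonneg _ _ _) (fun n => partDist_add_zero_le _ _ _) h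
  smul_mem' := by
    rintro b v ⟨⟨D, hD⟩, hv⟩
    refine ⟨⟨‖b‖ * D, fun n => (partDist_smul_zero _ _ _).trans_le
      (mul_le_mul_of_nonneg_left (hD n) (norm_nonneg b))⟩, fun A hA => ?_⟩
    have h := (hv A hA).const_mul ‖b‖
    rw [mul_zero] at h
    exact h.congr fun n => (partDist_smul_zero _ _ _).symm

/-- A copy of `regularSubmodule` that carries the seminorm of the ultraproduct with base
points `y`. -/
def RegularSeq (q : ℝ) [Fact (1 ≤ q)] (𝕜 : Type) [RCLike 𝕜] {E : Type u}
    [NormedAddCommGroup E] [NormedSpace 𝕜 E] (U : Ultrafilter ℕ) {F : ℕ → Type}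
    [∀ n, Fintype (F n)] [∀ n, Nonempty (F n)] (_y : ∀ n, F n → E) (c : ℕ → ℝ) : Type u :=
  regularSubmodule q 𝕜 E U F c

namespace RegularSeq

instance : AddCommGroup (RegularSeq q 𝕜 U y c) :=
  inferInstanceAs (AddCommGroup (regularSubmodule q 𝕜 E U F c))

instance : Module 𝕜 (RegularSeq q 𝕜 U y c) :=
  inferInstanceAs (Module 𝕜 (regularSubmodule q 𝕜 E U F c))

theorem exists_bound (v : RegularSeq q 𝕜 U y c) :
    ∃ D : ℝ, ∀ n, partDist q Finset.univ (v.1 n + y n) (y n) ≤ D := by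
  obtain ⟨D, hD⟩ := v.2.1
  exact ⟨D, fun n => (partDist_add_right_self _ _ _).trans_le (hD n)⟩

/-- The translate of the base points by a sequence of vectors. -/
def shift (v : RegularSeq q 𝕜 U y c) : PreFolner q E U F y :=
  PreFolner.ofFun (fun n => v.1 n + y n) v.exists_bound

theorem shift_apply (v : RegularSeq q 𝕜 U y c) (n : ℕ) : (v.shift.1 n).1 = v.1 n + y n := rfl

theorem tendsto_dist_shift (v w : RegularSeq q 𝕜 U y c) :
    Tendsto (fun n => partDist q Finset.univ (v.1 n) (w.1 n)) U (𝓝 (dist v.shift w.shift)) := by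
  refine (PreFolner.tendsto_partDist v.shift w.shift).congr fun n => ?_
  exact partDist_congr fun x _ => by simp [shift_apply]

instance : SeminormedAddCommGroup (RegularSeq q 𝕜 U y c) where
  norm v := dist v.shift (0 : RegularSeq q 𝕜 U y c).shift
  toPseudoMetricSpace := PseudoMetricSpace.induced shift inferInstance
  dist_eq v w := by
    refine tendsto_nhds_unique (tendsto_dist_shift v w)
      ((tendsto_dist_shift (-v + w) 0).congr fun n => partDist_congr fun x _ => ?_)
    change dist (-v.1 n x + w.1 n x) 0 = dist (v.1 n x) (w.1 n x)
    rw [dist_zero_right, dist_comm, dist_eq_norm, neg_add_eq_sub]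

theorem dist_eq_dist_shift (v w : RegularSeq q 𝕜 U y c) : dist v w = dist v.shift w.shift := rfl

theorem norm_eq_dist_shift (v : RegularSeq q 𝕜 U y c) :
    ‖v‖ = dist v.shift (0 : RegularSeq q 𝕜 U y c).shift := rfl

instance : NormedSpace 𝕜 (RegularSeq q 𝕜 U y c) where
  norm_smul_le b v := by
    rw [norm_eq_dist_shift, norm_eq_dist_shift]
    refine le_of_eq (tendsto_nhds_unique (tendsto_dist_shift (b • v) 0)
      (((tendsto_dist_shift v 0).const_mul ‖b‖).congr fun n => ?_))
    exact (partDist_smul_zero _ b (v.1 n)).symm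

theorem isRegular_shift (v : RegularSeq q 𝕜 U y c) : v.shift.IsRegular c := fun A hA =>
  (v.2.2 A hA).congr fun _ => (partDist_add_right_self _ _ _).symm

theorem exists_shift_eq {z : PreFolner q E U F y} (hz : z.IsRegular c) :
    ∃ v : RegularSeq q 𝕜 U y c, v.shift = z := by
  have h : ∀ n (A : Finset (F n)),
      partDist q A ((z.1 n).1 - y n) 0 = partDist q A (z.1 n).1 (y n) := fun n A =>
    partDist_congr fun x _ => by simp [dist_eq_norm]
  obtain ⟨D, hD⟩ := z.exists_bound
  refine ⟨⟨fun n => (z.1 n).1 - y n, ⟨D, fun n => (h n _).trans_le (hD n)⟩, fun A hA =>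
    (hz A hA).congr fun n => (h n _).symm⟩, ?_⟩
  refine Subtype.ext (funext fun n => Subtype.ext ?_)
  exact sub_add_cancel _ _

theorem shift_lineMap (b : 𝕜) (v w : RegularSeq q 𝕜 U y c) :
    ((1 - b) • v + b • w).shift = preLineMap b v.shift w.shift := by
  refine Subtype.ext (funext fun n => Subtype.ext (funext fun x => ?_))
  change (1 - b) • v.1 n x + b • w.1 n x + y n x =
    AffineMap.lineMap (v.1 n x + y n x) (w.1 n x + y n x) b
  rw [AffineMap.lineMap_apply_module]
  module

/-- The translation of the base point identifies the normed space of regular sequences of vectors,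
modulo null vectors, with the regular part of the ultraproduct. -/
theorem exists_isometryEquiv_regularPart (q : ℝ) [Fact (1 ≤ q)] (𝕜 : Type) [RCLike 𝕜] {E : Type u}
    [NormedAddCommGroup E] [NormedSpace 𝕜 E] (U : Ultrafilter ℕ) {F : ℕ → Type}
    [∀ n, Fintype (F n)] [∀ n, Nonempty (F n)] (y : ∀ n, F n → E) (c : ℕ → ℝ) :
    ∃ φ : SeparationQuotient (RegularSeq q 𝕜 U y c) ≃ᵢ regularPart q U y c,
      ∀ (b : 𝕜) (v w : SeparationQuotient (RegularSeq q 𝕜 U y c)),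
        (φ (AffineMap.lineMap v w b) : FolnerSpace q E U F y) =
          FolnerSpace.lineMap b (φ v) (φ w) := by
  let f : SeparationQuotient (RegularSeq q 𝕜 U y c) → regularPart q U y c :=
    SeparationQuotient.lift
      (fun v => ⟨SeparationQuotient.mk v.shift, mk_mem_regularPart.2 v.isRegular_shift⟩)
      fun v w h => by
        refine Subtype.ext ?_
        rw [SeparationQuotient.mk_eq_mk, Metric.inseparable_iff, ← dist_eq_dist_shift]
        exact Metric.inseparable_iff.1 h
  have hf : ∀ v, (f (SeparationQuotient.mk v) : FolnerSpace q E U F y) =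
      SeparationQuotient.mk v.shift := fun v => rfl
  have hiso : Isometry f := Isometry.of_dist_eq fun v w => by
    obtain ⟨v, rfl⟩ := SeparationQuotient.surjective_mk v
    obtain ⟨w, rfl⟩ := SeparationQuotient.surjective_mk w
    rw [Subtype.dist_eq, hf, hf, SeparationQuotient.dist_mk, SeparationQuotient.dist_mk,
      dist_eq_dist_shift]
  have hsurj : Function.Surjective f := by
    rintro ⟨_, z, hz, rfl⟩
    obtain ⟨v, rfl⟩ := exists_shift_eq (𝕜 := 𝕜) hz
    exact ⟨SeparationQuotient.mk v, rfl⟩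
  refine ⟨⟨Equiv.ofBijective f ⟨hiso.injective, hsurj⟩, hiso⟩, fun b v w => ?_⟩
  obtain ⟨v, rfl⟩ := SeparationQuotient.surjective_mk v
  obtain ⟨w, rfl⟩ := SeparationQuotient.surjective_mk w
  change (f _ : FolnerSpace q E U F y) = FolnerSpace.lineMap b (f _).1 (f _).1
  rw [AffineMap.lineMap_apply_module, ← SeparationQuotient.mk_smul, ← SeparationQuotient.mk_smul,
    ← SeparationQuotient.mk_add, hf, hf, hf, shift_lineMap]
  rfl

end RegularSeq

/-- The regular part of an ultraproduct over a Banach space `E` belongs to `FS_q`. -/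
theorem FSqBanach_toMetricClass_regularPart {𝓔 : BanachClass.{u} 𝕜} [CompleteSpace E] (hE : 𝓔 E)
    (hUF : IsAdmissible U F) :
    (FSqBanach q 𝓔).toMetricClass (regularPart q U y c) := by
  have hU : (U : Filter ℕ) ≤ atTop := by
    rw [← Nat.cofinite_eq_atTop]; exact hUF.1
  obtain ⟨φ, hφ⟩ := RegularSeq.exists_isometryEquiv_regularPart q 𝕜 U y c
  have hcomp : CompleteSpace (PreFolner q E U F y) := PreUltraproduct.completeSpace hU
  have hcomp' : CompleteSpace (regularPart q U y c) :=
    isClosed_regularPart.completeSpace_coe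
  refine ⟨SeparationQuotient (RegularSeq q 𝕜 U y c), inferInstance, inferInstance,
    φ.completeSpace, ?_, ⟨φ.symm⟩⟩
  refine ⟨E, inferInstance, inferInstance, inferInstance, U, F, inferInstance, inferInstance, y,
    regularPart q U y c, hE, hUF, regularPart_nonempty, isClosed_regularPart, ?_, φ, hφ⟩
  intro b z hz w hw
  have h := hφ b (φ.symm ⟨z, hz⟩) (φ.symm ⟨w, hw⟩)
  rw [φ.apply_symm_apply, φ.apply_symm_apply] at h
  rw [← h]
  exact Subtype.coe_prop _

end Banach

/-! ### From fibred coarse embeddings to the Cayley boundary -/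

theorem HasFibredEmbedding.congr {ρ ω : ℝ≥0 → ℝ≥0} {X : ℕ → Type v} [∀ m, MetricSpace (X m)]
    {M M' : Type u} [MetricSpace M] [MetricSpace M'] (h : HasFibredEmbedding ρ ω X M)
    (e : M ≃ᵢ M') : HasFibredEmbedding ρ ω X M' := by
  obtain ⟨fib, inst, hfib, s, hs⟩ := h
  refine ⟨fib, inst, fun x => (hfib x).map fun f => f.trans e, s, fun R => ?_⟩
  obtain ⟨m₀, hm₀, t, h1, h2⟩ := hs R
  refine ⟨m₀, hm₀, fun C x => (t C x).trans e, fun C hC x₁ hx₁ x₂ hx₂ => ?_,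
    fun C₁ C₂ hC₁ hC₂ hne => ?_⟩
  · simp only [IsometryEquiv.trans_apply, e.isometry.nndist_eq]
    exact h1 C hC x₁ hx₁ x₂ hx₂
  · obtain ⟨τ, hτ⟩ := h2 C₁ C₂ hC₁ hC₂ hne
    refine ⟨(e.symm.trans τ).trans e, fun x hx => ?_⟩
    rw [← hτ x hx]
    rfl

/-- Along an ultrafilter, a fibred coarse embedding may be restricted to balls `B(x, r n)` in the
component `n` with radii `r n` that tend to infinity. The point `e n x z` is the value of the
section at `z` in the trivialization over the ball around `x`, and `T n x z` is the transition, at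
the point `z`, from the trivialization over the ball around `z` to the one over the ball
around `x`. -/
theorem HasFibredEmbedding.exists_transition {ρ ω : ℝ≥0 → ℝ≥0} {X : ℕ → Type v}
    [∀ m, MetricSpace (X m)] {M : Type u} [MetricSpace M] (h : HasFibredEmbedding ρ ω X M)
    {U : Ultrafilter ℕ} (hU : (U : Filter ℕ) ≤ atTop) :
    ∃ (T : ∀ n, X n → X n → (M ≃ᵢ M)) (e : ∀ n, X n → X n → M) (r : ℕ → ℕ),
      Tendsto r U atTop ∧ (∀ n x, T n x x = IsometryEquiv.refl M) ∧
      (∀ n x z, T n x z (e n z z) = e n x z) ∧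
      (∀ᶠ n in U, ∀ x z z' : X n, nndist z x ≤ r n → nndist z' x ≤ r n →
        ρ (nndist z z') ≤ nndist (e n x z) (e n x z') ∧
          nndist (e n x z) (e n x z') ≤ ω (nndist z z')) ∧
      ∀ᶠ n in U, ∀ x x' z : X n, nndist x' x ≤ r n → nndist z x ≤ r n → nndist z x' ≤ r n →
        ∀ p, T n x z p = T n x x' (T n x' z p) := by
  obtain ⟨fib, inst, -, s, hs⟩ := h
  choose m₀ _ t h1 h2 using hs
  obtain ⟨r, hr, hrm⟩ := exists_tendsto_atTop_of_eventually
    (P := fun N n => m₀ (2 * N) ≤ n) hU fun N => hU (eventually_ge_atTop _)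
  let C : ∀ n, X n → Set (DisjointUnion X) := fun n x => {p | ∃ z, p = ⟨n, z⟩ ∧ nndist z x ≤ r n}
  have hCmem : ∀ {n} {x z : X n}, nndist z x ≤ r n → (⟨n, z⟩ : DisjointUnion X) ∈ C n x :=
    fun hz => ⟨_, rfl, hz⟩
  have hC : ∀ᶠ n in U, ∀ x : X n, IsSmallBeyond (m₀ (2 * r n)) (2 * r n) (C n x) := by
    filter_upwards [hrm] with n hn x
    refine ⟨⟨_, hCmem (z := x) (by simp)⟩, ?_, Metric.ediam_le ?_⟩
    · rintro _ ⟨z, rfl, -⟩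
      exact hn
    · rintro _ ⟨z, rfl, hz⟩ _ ⟨z', rfl, hz'⟩
      rw [DisjointUnion.edist_mk, edist_nndist]
      have h3 := nndist_triangle_right z z' x
      have h4 : nndist z z' ≤ 2 * r n := by
        rw [two_mul]; exact h3.trans (add_le_add hz hz')
      exact_mod_cast h4
  let pt : ∀ n, X n → DisjointUnion X := fun n z => ⟨n, z⟩
  let tt : ∀ n (x z : X n), fib (pt n z) ≃ᵢ M := fun n x z => t (2 * r n) (C n x) (pt n z)
  refine ⟨fun n x z => (tt n z z).symm.trans (tt n x z), fun n x z => tt n x z (s (pt n z)), r, hr,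
    fun n x => IsometryEquiv.ext (tt n x x).apply_symm_apply, fun n x z => ?_, ?_, ?_⟩
  · simp
  · filter_upwards [hC] with n hn x z z' hz hz'
    have h3 := h1 (2 * r n) (C n x) (hn x) _ (hCmem hz) _ (hCmem hz')
    rwa [DisjointUnion.toNNReal_edist_mk] at h3
  · filter_upwards [hC] with n hn x x' z hx' hz hz' p
    obtain ⟨τ, hτ⟩ := h2 (2 * r n) (C n x) (C n x') (hn x) (hn x')
      ⟨_, hCmem hz, hCmem hz'⟩
    have e1 : (tt n x' x').symm.trans (tt n x x') = τ := hτ _ ⟨hCmem hx', hCmem (by simp)⟩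
    have e2 : (tt n x' z).symm.trans (tt n x z) = τ := hτ _ ⟨hCmem hz, hCmem hz'⟩
    rw [e1, ← e2]
    simp

namespace MarkedGroup

variable {k : ℕ} {G : ℕ → MarkedGroup k} {H : MarkedGroup k} {l : Filter ℕ}

theorem eventually_nndist_proj_eq (h : Tendsto G l (𝓝 H)) (v w : FreeGroup (Fin k)) :
    ∀ᶠ n in l, nndist ((G n).proj v) ((G n).proj w) = nndist (H.proj v) (H.proj w) := by
  filter_upwards [eventually_agree h (2 * (v.toWord.length + w.toWord.length))] with n hn
  have := hn.nndist_eq (L₁ := v.toWord) (L₂ := w.toWord) le_rfl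
  rwa [FreeGroup.mk_toWord, FreeGroup.mk_toWord] at this

theorem eventually_proj_eq (h : Tendsto G l (𝓝 H)) {v w : FreeGroup (Fin k)}
    (hvw : H.proj v = H.proj w) : ∀ᶠ n in l, (G n).proj v = (G n).proj w := by
  filter_upwards [eventually_nndist_proj_eq h v w] with n hn
  rwa [hvw, nndist_self, nndist_eq_zero] at hn

/-- A word that represents a given element. -/
def lift (H : MarkedGroup k) (g : H.Carrier) : FreeGroup (Fin k) :=
  Function.surjInv H.proj_surjective g

theorem proj_lift (H : MarkedGroup k) (g : H.Carrier) : H.proj (H.lift g) = g :=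
  Function.surjInv_eq H.proj_surjective g

end MarkedGroup

/-- A fibred coarse embedding of the `G n` induces an action of a limit group `H` on the regular
part of an ultraproduct. The index sets are finite subsets `K n` of the groups `G n`, each repeated
`n + 1` times to make the cardinalities tend to infinity. They are almost invariant: translation by
a word `w` leaves `K n` only at the points of `A n w`, which form a null sequence. -/
theorem HasFibredEmbedding.exists_isEquivariantControlPair {k : ℕ} {ρ ω : ℝ≥0 → ℝ≥0}
    {G : ℕ → MarkedGroup k} {M : Type u} [MetricSpace M]
    (hfe : HasFibredEmbedding ρ ω (fun m => (G m).Carrier) M) {U : Ultrafilter ℕ}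
    (hU : (U : Filter ℕ) ≤ atTop) {H : MarkedGroup k} (hG : Tendsto G U (𝓝 H))
    {q : ℝ} [Fact (1 ≤ q)] (K : ∀ n, Finset (G n).Carrier) [∀ n, Nonempty (K n × Fin (n + 1))]
    {c : ℕ → ℝ} (hc : ∀ n, 1 / (Fintype.card (K n × Fin (n + 1)) : ℝ) ≤ c n)
    (A : ∀ n, FreeGroup (Fin k) → Finset (K n × Fin (n + 1)))
    (hA : ∀ n w x, x ∉ A n w → (G n).proj w * x.1 ∈ K n)
    (hnull : ∀ w, IsNull U c fun n => A n w) :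
    ∃ y : ∀ n, K n × Fin (n + 1) → M,
      IsEquivariantControlPair ρ ω H (regularPart q U y c) := by
  classical
  obtain ⟨T, e, r, hr, hT1, hTe, hcp, hcoc⟩ := hfe.exists_transition hU
  let τ : ∀ n, H.Carrier → (G n).Carrier := fun n g => (G n).proj (H.lift g)
  have hτdist : ∀ g h, ∀ᶠ n in U, nndist (τ n g) (τ n h) = nndist g h := fun g h => by
    filter_upwards [MarkedGroup.eventually_nndist_proj_eq hG (H.lift g) (H.lift h)] with n hn
    rwa [H.proj_lift, H.proj_lift] at hn
  have hτone : ∀ᶠ n in U, τ n 1 = 1 := by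
    filter_upwards [MarkedGroup.eventually_proj_eq hG (v := H.lift 1) (w := 1)
      (by rw [H.proj_lift, map_one])] with n hn
    rwa [map_one] at hn
  have hτmul : ∀ g h, ∀ᶠ n in U, τ n (g * h) = τ n g * τ n h := fun g h => by
    filter_upwards [MarkedGroup.eventually_proj_eq hG (v := H.lift (g * h))
      (w := H.lift g * H.lift h) (by simp only [map_mul, H.proj_lift])] with n hn
    rwa [map_mul] at hn
  have hball : ∀ g, ∀ᶠ n in U, ∀ x : (G n).Carrier,
      nndist (τ n g * x) x = nndist g 1 ∧ nndist (τ n g * x) x ≤ r n := fun g => by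
    obtain ⟨N, hN⟩ := exists_nat_ge (nndist g 1)
    filter_upwards [hτdist g 1, hτone, hr.eventually_ge_atTop N] with n h1 h2 h3 x
    have h4 : nndist (τ n g * x) x = nndist g 1 := by
      rw [← h1, h2, ← (G n).nndist_mul_right (τ n g) 1 x, one_mul]
    refine ⟨h4, h4.trans_le (hN.trans ?_)⟩
    exact_mod_cast h3
  let y : ∀ n, K n × Fin (n + 1) → M := fun n x => e n x.1 x.1
  let trans : ∀ n, H.Carrier → K n × Fin (n + 1) → K n × Fin (n + 1) := fun n g x =>
    if h : τ n g * x.1 ∈ K n then (⟨τ n g * x.1, h⟩, x.2) else x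
  have htrans1 : ∀ {n g} {x : K n × Fin (n + 1)}, τ n g * x.1 ∈ K n →
      ((trans n g x).1 : (G n).Carrier) = τ n g * x.1 := fun {n g x} hx => by
    simp only [trans, dif_pos hx]
  have htrans2 : ∀ {n g} {x : K n × Fin (n + 1)}, (trans n g x).2 = x.2 := fun {n g x} => by
    by_cases h : τ n g * x.1 ∈ K n
    · simp only [trans, dif_pos h]
    · simp only [trans, dif_neg h]
  let iso : ∀ n, H.Carrier → K n × Fin (n + 1) → M ≃ᵢ M := fun n g x => T n x.1 (τ n g * x.1)
  have hiso : ∀ {n g} {x : K n × Fin (n + 1)}, τ n g * x.1 ∈ K n →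
      iso n g x (y n (trans n g x)) = e n x.1 (τ n g * x.1) := fun {n g x} hx => by
    simp only [iso, y]
    rw [htrans1 hx, hTe]
  -- The bound by `ω` holds almost always; it is built into the domain to make it hold always.
  let dom : ∀ n, H.Carrier → Finset (K n × Fin (n + 1)) := fun n g =>
    Finset.univ.filter fun x => τ n g * x.1 ∈ K n ∧
      dist (iso n g x (y n (trans n g x))) (y n x) ≤ ω (nndist g 1)
  have hdom : ∀ {n g x}, x ∈ dom n g ↔ τ n g * x.1 ∈ K n ∧
      dist (iso n g x (y n (trans n g x))) (y n x) ≤ ω (nndist g 1) := by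
    simp [dom]
  have hc0 : ∀ n, 0 ≤ c n := fun n => le_trans (by positivity) (hc n)
  let a : AlmostAction H.Carrier U y c :=
    { dom := dom
      trans := trans
      iso := iso
      injOn := fun n g x hx x' hx' h => by
        have h1 := (hdom.1 hx).1
        have h2 := (hdom.1 hx').1
        refine Prod.ext (Subtype.ext ?_) ?_
        · refine mul_left_cancel (a := τ n g) ?_
          rw [← htrans1 h1, ← htrans1 h2, h]
        · rw [← htrans2 (g := g) (x := x), h, htrans2]
      isNull_compl := fun g => by
        refine (hnull (H.lift g)).of_card_le hc0 ?_
        filter_upwards [hball g, hcp] with n h1 h2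
        refine Finset.card_le_card fun x hx => ?_
        by_contra hxA
        refine Finset.mem_compl.1 hx (hdom.2 ?_)
        have hxK : τ n g * x.1 ∈ K n := hA n _ x hxA
        refine ⟨hxK, ?_⟩
        have h3 := (h2 x.1 (τ n g * x.1) x.1 (h1 x.1).2 (by simp)).2
        rw [hiso hxK, ← (h1 x.1).1, ← coe_nndist]
        exact_mod_cast h3
      exists_bound := fun g => ⟨ω (nndist g 1), fun n x hx => (hdom.1 hx).2⟩
      one := by
        filter_upwards [hτone] with n hn x hx
        have hx1 := (hdom.1 hx).1
        refine ⟨Prod.ext (Subtype.ext ?_) htrans2, ?_⟩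
        · rw [htrans1 hx1, hn, one_mul]
        · simp only [iso]
          rw [hn, one_mul, hT1]
      mul := fun g h => by
        filter_upwards [hτmul g h, hball g, hball h, hball (g * h), hcoc]
          with n h1 h2 h3 h4 h5 x hx hxg hxgh
        have e1 := htrans1 (hdom.1 hx).1
        have e2 := htrans1 (hdom.1 hxg).1
        have e3 := htrans1 (hdom.1 hxgh).1
        refine ⟨Prod.ext (Subtype.ext ?_) ?_, fun p => ?_⟩
        · rw [e2, e3, e1, h1, mul_assoc]
        · rw [htrans2, htrans2, htrans2]
        · have h6 := (h4 x.1).2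
          simp only [iso]
          rw [e1, h1, mul_assoc]
          rw [h1, mul_assoc] at h6
          exact h5 _ _ _ (h3 _).2 h6 (h2 _).2 p }
  refine ⟨y, ?_⟩
  obtain ⟨α, hα⟩ := a.exists_action_regularPart (q := q) hc
  refine ⟨α, ⟨SeparationQuotient.mk PreFolner.base,
    mk_mem_regularPart.2 PreFolner.isRegular_base⟩, fun g h => ?_⟩
  have hmem := a.dist_act_base_mem_Icc (q := q) hc (g := g) (h := h)
    (r := ρ (nndist g h)) (R := ω (nndist g h)) NNReal.zero_le_coe NNReal.zero_le_coe (by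
      filter_upwards [hball g, hball h, hτdist g h, hcp] with n h1 h2 h3 h4 x hxg hxh
      have h5 := h4 x.1 (τ n g * x.1) (τ n h * x.1) (h1 _).2 (h2 _).2
      rw [(G n).nndist_mul_right, h3] at h5
      change dist (iso n g x (y n (trans n g x))) (iso n h x (y n (trans n h x))) ∈ _
      rw [hiso (hdom.1 hxg).1, hiso (hdom.1 hxh).1, ← coe_nndist]
      exact ⟨NNReal.coe_le_coe.2 h5.1, NNReal.coe_le_coe.2 h5.2⟩)
  rw [← hα g ⟨_, mk_mem_regularPart.2 PreFolner.isRegular_base⟩,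
    ← hα h ⟨_, mk_mem_regularPart.2 PreFolner.isRegular_base⟩, ← Subtype.dist_eq,
    ← coe_nndist] at hmem
  exact ⟨NNReal.coe_le_coe.1 hmem.1, NNReal.coe_le_coe.1 hmem.2⟩

theorem IsEquivariantControlPair.congr {k : ℕ} {ρ ω : ℝ≥0 → ℝ≥0} {H : MarkedGroup k}
    {M M' : Type u} [MetricSpace M] [MetricSpace M'] (h : IsEquivariantControlPair ρ ω H M)
    (e : M ≃ᵢ M') : IsEquivariantControlPair ρ ω H M' := by
  obtain ⟨α, y, hα⟩ := h
  refine ⟨{ toFun := fun g => (e.symm.trans (α g)).trans e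
            map_one' := by ext; simp
            map_mul' := fun g h => by ext; simp }, e y, fun g h => ?_⟩
  simpa [e.isometry.nndist_eq] using hα g h

theorem isAdmissible_prod_fin {U : Ultrafilter ℕ} (hU : (U : Filter ℕ) ≤ atTop) (K : ℕ → Type)
    [∀ n, Fintype (K n)] [∀ n, Nonempty (K n)] : IsAdmissible U fun n => K n × Fin (n + 1) := by
  refine ⟨by rwa [Nat.cofinite_eq_atTop], tendsto_atTop_mono (fun n => ?_) tendsto_id⟩
  rw [Fintype.card_prod, Fintype.card_fin]
  have : 1 ≤ Fintype.card (K n) := Fintype.card_pos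
  calc n ≤ 1 * (n + 1) := by omega
    _ ≤ _ := Nat.mul_le_mul_right _ this

/-- For finite groups the index sets are the whole groups, and the action is defined on the whole
ultraproduct. -/
theorem HasFibredEmbedding.exists_isEquivariantControlPair_of_finite {k : ℕ} {ρ ω : ℝ≥0 → ℝ≥0}
    {G : ℕ → MarkedGroup k} (hfin : ∀ m, Finite (G m).Carrier) {M : Type u} [MetricSpace M]
    (hfe : HasFibredEmbedding ρ ω (fun m => (G m).Carrier) M) {H : MarkedGroup k}
    (hH : H ∈ cayleyBoundary G) (q : ℝ) [Fact (1 ≤ q)] :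
    ∃ (L : Type u) (_ : MetricSpace L), FqOf q M L ∧ IsEquivariantControlPair ρ ω H L := by
  obtain ⟨U, hU, hG⟩ := mapClusterPt_iff_ultrafilter.1 hH
  let _ : ∀ m, Fintype (G m).Carrier := fun m => Fintype.ofFinite _
  let K : ∀ n, Finset (G n).Carrier := fun n => Finset.univ
  have hne : ∀ n, Nonempty (K n) := fun n => ⟨⟨1, Finset.mem_univ _⟩⟩
  have hc : ∀ n, 1 / (Fintype.card (K n × Fin (n + 1)) : ℝ) ≤ 1 := fun n => by
    have h1 : (1 : ℝ) ≤ Fintype.card (K n × Fin (n + 1)) := by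
      exact_mod_cast Nat.succ_le_of_lt Fintype.card_pos
    exact div_le_one_of_le₀ h1 (by positivity)
  obtain ⟨y, hy⟩ := hfe.exists_isEquivariantControlPair hU hG (q := q) K
    (c := fun _ => 1) hc (fun _ _ => ∅) (fun _ _ _ _ => Finset.mem_univ _) fun _ => isNull_empty
  refine ⟨_, inferInstance, ⟨U, _, inferInstance, inferInstance, y,
    isAdmissible_prod_fin hU _, ⟨IsometryEquiv.refl _⟩⟩, hy.congr ?_⟩
  exact ⟨(Equiv.setCongr regularPart_one).trans (Equiv.Set.univ _), fun _ _ => rfl⟩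

open Classical in
/-- For amenable groups the index sets are Følner sets, with the density as weight. The `n`-th
Følner set is almost invariant under the first `n` words, in an enumeration of all words. -/
theorem HasFibredEmbedding.exists_isEquivariantControlPair_of_amenable {k : ℕ} {ρ ω : ℝ≥0 → ℝ≥0}
    {G : ℕ → MarkedGroup k} (ham : ∀ m, IsAmenableGroup (G m).Carrier) {M : Type u} [MetricSpace M]
    (hfe : HasFibredEmbedding ρ ω (fun m => (G m).Carrier) M) {H : MarkedGroup k}
    (hH : H ∈ cayleyBoundary G) (q : ℝ) [Fact (1 ≤ q)] :
    ∃ (U : Ultrafilter ℕ) (F : ℕ → Type) (_ : ∀ m, Fintype (F m)) (_ : ∀ m, Nonempty (F m))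
      (y : ∀ m, F m → M) (c : ℕ → ℝ), IsAdmissible U F ∧
        IsEquivariantControlPair ρ ω H (regularPart q U y c) := by
  obtain ⟨U, hU, hG⟩ := mapClusterPt_iff_ultrafilter.1 hH
  have : Countable (FreeGroup (Fin k)) := Quot.mk_surjective.countable
  obtain ⟨enum, henum⟩ := exists_surjective_nat (FreeGroup (Fin k))
  choose K hK hKF using fun n => ham n
    ((Finset.range n).image fun i => (G n).proj (enum i)) (1 / ((n : ℝ) + 1))
    Nat.one_div_pos_of_nat
  have hne : ∀ n, Nonempty (K n) := fun n => (hK n).to_subtype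
  let A : ∀ n, FreeGroup (Fin k) → Finset (K n × Fin (n + 1)) := fun n w =>
    (Finset.univ.filter fun x : K n => (G n).proj w * x ∉ K n) ×ˢ Finset.univ
  let c : ℕ → ℝ := fun n => 1 / (Fintype.card (K n × Fin (n + 1)) : ℝ)
  have hcard : ∀ n w, (G n).proj w ∈ ((Finset.range n).image fun i => (G n).proj (enum i)) →
      c n * (A n w).card ≤ 1 / ((n : ℝ) + 1) := by
    intro n w hw
    have h1 : (Finset.univ.filter fun x : K n => (G n).proj w * x ∉ K n).card ≤
        ((K n).image (fun x => (G n).proj w * x) \ K n).card := by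
      refine Finset.card_le_card_of_injOn (fun x => (G n).proj w * x) (fun x hx => ?_)
        fun x _ x' _ h => Subtype.ext (mul_left_cancel h)
      exact Finset.mem_coe.2 (Finset.mem_sdiff.2
        ⟨Finset.mem_image_of_mem _ x.2, (Finset.mem_filter.1 hx).2⟩)
    have h2 : ((Finset.univ.filter fun x : K n => (G n).proj w * x ∉ K n).card : ℝ) ≤
        1 / ((n : ℝ) + 1) * (K n).card := le_trans (by exact_mod_cast h1) (hKF n _ hw)
    have hK0 : (0 : ℝ) < (K n).card := by exact_mod_cast (hK n).card_pos
    have hn0 : (0 : ℝ) < (n : ℝ) + 1 := by positivity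
    simp only [c, A]
    rw [Fintype.card_prod, Finset.card_product, Finset.card_univ, Fintype.card_fin,
      Fintype.card_coe, Nat.cast_mul, Nat.cast_mul, Nat.cast_add, Nat.cast_one, one_div_mul_eq_div,
      mul_div_mul_right _ _ hn0.ne', div_le_iff₀ hK0]
    exact h2
  obtain ⟨y, hy⟩ := hfe.exists_isEquivariantControlPair hU hG (q := q) K
    (c := c) (fun n => le_rfl) A
    (fun n w x hx => by
      by_contra h
      exact hx (Finset.mem_product.2 ⟨Finset.mem_filter.2 ⟨Finset.mem_univ _, h⟩,
        Finset.mem_univ _⟩))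
    fun w => by
      obtain ⟨i, rfl⟩ := henum w
      refine squeeze_zero' (Eventually.of_forall fun n => by positivity) ?_
        (tendsto_one_div_add_atTop_nhds_zero_nat.mono_left hU)
      filter_upwards [hU (eventually_gt_atTop i)] with n hn
      exact hcard n _ (Finset.mem_image_of_mem _ (Finset.mem_range.2 hn))
  exact ⟨U, _, inferInstance, inferInstance, y, c, isAdmissible_prod_fin hU _, hy⟩

theorem fibredCP_subset_Fq {k : ℕ} {G : ℕ → MarkedGroup k} (𝓜 : MetricClass.{u})
    (hfin : ∀ m, Finite (G m).Carrier) (q : ℝ) [Fact (1 ≤ q)] :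
    fibredCP 𝓜 G ⊆ ⋂ H ∈ cayleyBoundary G, equivariantCP (Fq q 𝓜) H := by
  rintro p ⟨h1, h2, M, _, hM, hfe⟩
  refine Set.mem_iInter₂.2 fun H hH => ?_
  obtain ⟨L, _, hL, hcp⟩ := hfe.exists_isEquivariantControlPair_of_finite hfin hH q
  exact ⟨h1, h2, L, inferInstance, ⟨M, inferInstance, hM, hL⟩, hcp⟩

theorem fibredCP_subset_FSq {k : ℕ} {G : ℕ → MarkedGroup k} (𝓜 : MetricClass.{u})
    (ham : ∀ m, IsAmenableGroup (G m).Carrier) (q : ℝ) [Fact (1 ≤ q)] :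
    fibredCP 𝓜 G ⊆ ⋂ H ∈ cayleyBoundary G, equivariantCP (FSq q 𝓜) H := by
  rintro p ⟨h1, h2, M, _, hM, hfe⟩
  refine Set.mem_iInter₂.2 fun H hH => ?_
  obtain ⟨U, F, _, _, y, c, hUF, hcp⟩ :=
    hfe.exists_isEquivariantControlPair_of_amenable ham hH q
  exact ⟨h1, h2, regularPart q U y c, inferInstance, ⟨FolnerSpace q M U F y, inferInstance,
    ⟨M, inferInstance, hM, U, F, inferInstance, inferInstance, y, hUF, ⟨IsometryEquiv.refl _⟩⟩,
    regularPart q U y c, regularPart_nonempty, isClosed_regularPart,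
    isGeodesicallyConvex_regularPart, ⟨IsometryEquiv.refl _⟩⟩, hcp⟩

theorem fibredCP_subset_FSqBanach {k : ℕ} {G : ℕ → MarkedGroup k} (𝓜 : MetricClass.{u})
    (ham : ∀ m, IsAmenableGroup (G m).Carrier) {𝕜 : Type} [RCLike 𝕜] (𝓔 : BanachClass.{u} 𝕜)
    (h𝓔 : ∀ (M : Type u) [MetricSpace M], 𝓜 M → 𝓔.toMetricClass M) (q : ℝ) [Fact (1 ≤ q)] :
    fibredCP 𝓜 G ⊆ ⋂ H ∈ cayleyBoundary G, equivariantCP (FSqBanach q 𝓔).toMetricClass H := by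
  rintro p ⟨h1, h2, M, _, hM, hfe⟩
  refine Set.mem_iInter₂.2 fun H hH => ?_
  obtain ⟨E, _, _, _, hE, ⟨e⟩⟩ := h𝓔 M hM
  obtain ⟨U, F, _, _, y, c, hUF, hcp⟩ :=
    (hfe.congr e).exists_isEquivariantControlPair_of_amenable ham hH q
  exact ⟨h1, h2, regularPart q U y c, inferInstance,
    FSqBanach_toMetricClass_regularPart hE hUF, hcp⟩

end

/-! ### The characterization of fibred coarse embeddings -/

theorem mainTheorem1 (k : ℕ) (hk : 1 ≤ k) (G : ℕ → MarkedGroup k)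
    (𝓜 : MetricClass.{u}) (h𝓜 : ∃ (M : Type u) (_ : MetricSpace M), 𝓜 M) :
    -- (i)(1): finite groups
    ((∀ m, Finite (G m).Carrier) → ∀ (q : ℝ) [Fact (1 ≤ q)],
      (AdmitsFibredEmbedding 𝓜 G → UniformlyMenable (Fq q 𝓜) (cayleyBoundary G)) ∧
      fibredCP 𝓜 G ⊆ ⋂ H ∈ cayleyBoundary G, equivariantCP (Fq q 𝓜) H) ∧
    -- (i)(2), first case: amenable groups, under the unique geodesic assumption for `q`
    ((∀ m, IsAmenableGroup (G m).Carrier) → ∀ (q : ℝ) [Fact (1 ≤ q)], 1 < q →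
      (∀ (M : Type u) [MetricSpace M], 𝓜 M →
        ∃ (L : Type u) (_ : MetricSpace L), FqOf q M L ∧ IsUniquelyGeodesic L) →
      (AdmitsFibredEmbedding 𝓜 G → UniformlyMenable (FSq q 𝓜) (cayleyBoundary G)) ∧
      fibredCP 𝓜 G ⊆ ⋂ H ∈ cayleyBoundary G, equivariantCP (FSq q 𝓜) H) ∧
    -- (i)(2), second case: amenable groups, and `𝓜` consists of Banach spaces, those in `𝓔`
    ((∀ m, IsAmenableGroup (G m).Carrier) → ∀ (𝕜 : Type) [RCLike 𝕜] (𝓔 : BanachClass.{u} 𝕜),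
      (∀ (M : Type u) [MetricSpace M], 𝓜 M → 𝓔.toMetricClass M) → ∀ (q : ℝ) [Fact (1 ≤ q)],
      (AdmitsFibredEmbedding 𝓜 G →
        UniformlyMenable (FSqBanach q 𝓔).toMetricClass (cayleyBoundary G)) ∧
      fibredCP 𝓜 G ⊆ ⋂ H ∈ cayleyBoundary G, equivariantCP (FSqBanach q 𝓔).toMetricClass H) ∧
    -- (ii): from the Cayley boundary to fibred coarse embeddings
    (∀ (q : ℝ) [Fact (1 ≤ q)],
      (UniformlyMenable 𝓜 (cayleyBoundary G) → AdmitsFibredEmbedding (ellq q 𝓜) G) ∧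
      (⋂ H ∈ cayleyBoundary G, equivariantCP 𝓜 H) ⊆ fibredCP (ellq q 𝓜) G) ∧
    -- (ii), convergent sequences
    (∀ Ginf : MarkedGroup k, Tendsto G atTop (𝓝 Ginf) →
      (UniformlyMenable 𝓜 (cayleyBoundary G) → AdmitsFibredEmbedding 𝓜 G) ∧
      (⋂ H ∈ cayleyBoundary G, equivariantCP 𝓜 H) ⊆ fibredCP 𝓜 G ∧
      equivariantCP 𝓜 Ginf ⊆ fibredCP 𝓜 G) := by
  refine ⟨fun hfin q _ => ?_, fun ham q _ _ _ => ?_, fun ham 𝕜 _ 𝓔 h𝓔 q _ => ?_, fun q _ => ?_,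
    fun Ginf hG => ?_⟩
  · have h := fibredCP_subset_Fq 𝓜 hfin q
    exact ⟨fun hne => hne.mono h, h⟩
  · have h := fibredCP_subset_FSq 𝓜 ham q
    exact ⟨fun hne => hne.mono h, h⟩
  · have h := fibredCP_subset_FSqBanach 𝓜 ham 𝓔 h𝓔 q
    exact ⟨fun hne => hne.mono h, h⟩
  · have h := iInter_equivariantCP_subset_fibredCP_ellq 𝓜 G q
    exact ⟨fun hne => hne.mono h, h⟩
  · have h := equivariantCP_subset_fibredCP (𝓜 := 𝓜) hG
    have h' : (⋂ H ∈ cayleyBoundary G, equivariantCP 𝓜 H) ⊆ fibredCP 𝓜 G :=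
      (Set.biInter_subset_of_mem (show Ginf ∈ cayleyBoundary G from hG.mapClusterPt)).trans h
    exact ⟨fun hne => hne.mono h', h', h⟩
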